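/- Let $\gamma>1$ and $\alpha\ge 0$ be real numbers. A signature of length $N$ is an $N$-tuple of integers $\lambda_1\ge\lambda_2\ge\dots\ge\lambda_N$; let $\hat U(N)$ be the set of these, and for $\lambda\in\hat U(N)$ let $$\chi^{\lambda}(u_1,\dots,u_N)=\frac{\det\big(u_i^{\lambda_j+N-j}\big)_{i,j=1}^N}{\prod_{i<j}(u_i-u_j)}$$ be the rational Schur function (extended by continuity to coinciding arguments). For every $N\ge 1$ let $\varrho(N)$ be a probability measure on $\hat U(N)$ with Schur generating function $$\sum_{\lambda\in\hat U(N)}\varrho(N)[\lambda]\,\frac{\chi^\lambda(u_1,\dots,u_N)}{\chi^\lambda(1,\dots,1)}=\prod_{i=1}^N\frac{\exp(\gamma N(u_i-1))}{1-\alpha(u_i-1)},\qquad |u_1|=\dots=|u_N|=1 .$$ Let $I=[(\sqrt\gamma-1)^2,(\sqrt\gamma+1)^2]$, let $\mu_{dBBP}$ be the measure $$d\mu_{dBBP}=\frac1\pi\,\mathbf 1_{t\in I}\,\arccos\left(\frac{t-1+\gamma}{2\sqrt{\gamma t}}\right)dt,$$ and let $\mu'_{dBBP}$ be the signed measure $$d\mu'_{dBBP}=\left(\frac{\alpha(t-2\alpha-\gamma-1)}{\gamma+\alpha^2+\alpha\gamma+\alpha-\alpha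 t}-\frac{t+1-\gamma}{2t}\right)\frac{\mathbf 1_{t\in I}}{2\pi\sqrt{(\gamma+1+2\sqrt\gamma-t)(t-\gamma-1+2\sqrt\gamma)}}\,dt+\Big(\mathbf 1_{\alpha>\sqrt\gamma}+\tfrac12\mathbf 1_{\alpha=\sqrt\gamma}\Big)\,\delta\Big(\alpha+1+\gamma+\frac\gamma\alpha\Big)$$ (for $\alpha=0$ there is no atom). Then $\mu_{dBBP}$ is a probability measure, the density of the absolutely continuous part of $\mu'_{dBBP}$ is integrable, and $\mu'_{dBBP}$ has an atom exactly when $\alpha\ge\sqrt\gamma$; this atom is unique, located at $\alpha+1+\gamma+\gamma/\alpha$, and has mass $1$ if $\alpha>\sqrt\gamma$ and mass $\frac12$ if $\alpha=\sqrt\gamma$. Moreover, for every integer $k\ge 0$ all the moments below are finite (absolutely convergent), and as $N\to\infty$ $$\frac1N\sum_{\lambda\in\hat U(N)}\varrho(N)[\lambda]\sum_{i=1}^N\Big(\frac{\lambda_i+N-i}{N}\Big)^k=\int_{\mathbb R}t^k\,d\mu_{dBBP}+\frac1N\int_{\mathbb R}t^k\,d\mu'_{dBBP}+o\Big(\frac1N\Big).$$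 -/

import Mathlib

open MeasureTheory Filter Topology Asymptotics

noncomputable section

namespace DiscreteBBP

/-- Signatures of length `N`: weakly decreasing `N`-tuples of integers
`l 0 ≥ l 1 ≥ ⋯ ≥ l (N - 1)` (indices start at `0`). -/
abbrev Signature (N : ℕ) : Type := {l : Fin N → ℤ // Antitone l}

/-- The shifted coordinate `l_i + N - i` (for indices starting at `1`), that is
`l i + N - 1 - i` for indices starting at `0`. -/
def Signature.shifted {N : ℕ} (l : Signature N) (i : Fin N) : ℤ :=
  l.1 i + (N : ℤ) - 1 - (i : ℤ)

/-- The quotient `det (u_i ^ (l_j + N - j)) / ∏_{i < j} (u_i - u_j)`, meaningful when the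
coordinates of `u` are pairwise distinct (and nonzero). -/
def alternantRatio {N : ℕ} (l : Signature N) (u : Fin N → ℂ) : ℂ :=
  (Matrix.of fun i j : Fin N => u i ^ l.shifted j).det /
    ∏ i : Fin N, ∏ j ∈ Finset.Ioi i, (u i - u j)

/-- The rational Schur function (character of the irreducible representation of `U(N)` with
highest weight `l`): the quotient of alternants, extended by continuity from points with pairwise
distinct coordinates to all points with nonzero coordinates. -/
def schurFun {N : ℕ} (l : Signature N) : (Fin N → ℂ) → ℂ :=
  extendFrom {u : Fin N → ℂ | Function.Injective u} (alternantRatio l)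

/-- The Schur generating function `∑_l ρ(l) χ^l(u) / χ^l(1, …, 1)` of a probability measure `ρ` on
signatures. -/
def schurGenFun {N : ℕ} (ρ : PMF (Signature N)) (u : Fin N → ℂ) : ℂ :=
  ∑' l : Signature N, ((ρ l).toReal : ℂ) * (schurFun l u / schurFun l 1)

/-- The power sum `∑_i ((l_i + N - i) / N) ^ k`. -/
def powerSum {N : ℕ} (k : ℕ) (l : Signature N) : ℝ :=
  ∑ i : Fin N, ((l.shifted i : ℝ) / (N : ℝ)) ^ k

/-- The averaged `k`-th moment
`(1 / N) ∑_l ρ(l) ∑_i ((l_i + N - i) / N) ^ k` of the empirical measure. -/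
def averagedMoment {N : ℕ} (ρ : PMF (Signature N)) (k : ℕ) : ℝ :=
  (1 / (N : ℝ)) * ∑' l : Signature N, (ρ l).toReal * powerSum k l

/-- The interval `[(√γ - 1)², (√γ + 1)²]`. -/
def bulk (γ : ℝ) : Set ℝ := Set.Icc ((√γ - 1) ^ 2) ((√γ + 1) ^ 2)

/-- The limit measure: density `π⁻¹ arccos ((t - 1 + γ) / (2 √(γ t)))` on the bulk. -/
def limitMeasure (γ : ℝ) : Measure ℝ :=
  (volume.restrict (bulk γ)).withDensity fun t =>
    ENNReal.ofReal (1 / Real.pi * Real.arccos ((t - 1 + γ) / (2 * √(γ * t))))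

/-- The density of the absolutely continuous part of the correction measure, on the bulk. -/
def correctionDensity (γ α t : ℝ) : ℝ :=
  (α * (t - 2 * α - γ - 1) / (γ + α ^ 2 + α * γ + α - α * t) - (t + 1 - γ) / (2 * t)) *
    (1 / (2 * Real.pi * √((γ + 1 + 2 * √γ - t) * (t - γ - 1 + 2 * √γ))))

/-- The position of the outlier. -/
def outlier (γ α : ℝ) : ℝ := α + 1 + γ + γ / α

/-- The mass of the outlier: `1` if `α > √γ`, `1/2` if `α = √γ`, and `0` if `α < √γ`. -/
def outlierMass (γ α : ℝ) : ℝ :=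
  if √γ < α then 1 else if α = √γ then 1 / 2 else 0

/-- The correction measure: an absolutely continuous part on the bulk and an atom. -/
def correctionMeasure (γ α : ℝ) : SignedMeasure ℝ :=
  (volume.restrict (bulk γ)).withDensityᵥ (correctionDensity γ α) +
    VectorMeasure.dirac (outlier γ α) (outlierMass γ α)

end DiscreteBBP

end

/-! ### Power series with all moments, and their re-expansion at 1 -/

namespace DiscreteBBP
open PowerSeries

/-! Let b(u) = exp(γN(u-1)) / (1-α(u-1)) and f(x) = b(1+x). Multiplying the Schur generating
function by the Vandermonde product turns its right-hand side into det[(u_i-1)^j b(u_i)]. Its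
Fourier coefficients on the torus express ρ(l)/χ^l(1) as a determinant of Taylor coefficients of
(u-1)^j b at 0 (`div_schurFun_one_eq`). Up to the same sign, χ^l(1) is det C(n_i, j), where n_i are
the shifted coordinates. So ρ is a biorthogonal ensemble (`toReal_eq_det_mul_det`), carried by
nonnegative coordinates because b has no negative Fourier modes.

Linear statistics of such an ensemble follow from the Andréief identity `hasSum_det_mul_det`.
Pairing C(n, i) with the Taylor coefficients of a function at 0 gives its i-th Taylor coefficient at
1, so the Gram matrix [x^i] x^j f is lower unitriangular. Weighting by the falling factorial of n of
order k applies u^k ∂^k, that is (1+x)^k ∂^k, to one column r. By Cramer's rule the determinant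
becomes [x^r] of f⁻¹ (1+x)^k ∂^k (x^r f), and summing over r < N gives the exact formula
`hasSum_falling`.

In that formula a derivative hitting the exponential produces γN, while one hitting 1/(1-αx)
produces no N. Hence α enters only at relative order 1/N, through terms with exactly one such
derivative. Passing from falling factorials to powers gives M_k + (S_k - (k/2) M_{k-1})/N + o(1/N)
(`hasExpansion_averagedMoment`), with M = `limitMoment` and S = `spikeMoment`.

It remains to recognize these numbers as moments. Put t = (√γ + z)(√γ + z⁻¹) with z = exp(iθ), and r
= α/√γ. The rational part of the correction density becomes the oscillating part of the Poisson
kernel at r, with cosine coefficients proportional to r^n when r < 1. When r > 1 the same closed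
form has coefficients proportional to -r^(-n), and its defect from S_k is exactly t^k at z = r, the
outlier; at r = 1 the defect is half of that (`integral_bulkParam_pow_mul_poissonPart`). The rest of
the density is half the derivative of the limit density, so integration by parts yields -(k/2)
M_{k-1} and also identifies M_k (`integral_pow_mul_driftDensity`). -/

/-- All polynomial moments of the coefficients converge absolutely. -/
def HasMoments (b : ℝ⟦X⟧) : Prop := ∀ k : ℕ, Summable fun n : ℕ => ((n : ℝ) + 1) ^ k * |coeff n b|

/-- The expansion at `1` of the function with Taylor coefficients `b` at `0`. -/
noncomputable def recenter (b : ℝ⟦X⟧) : ℝ⟦X⟧ := mk fun i => ∑' n : ℕ, (n.choose i : ℝ) * coeff n b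

lemma HasMoments.summable_of_le {b : ℝ⟦X⟧} (hb : HasMoments b) {w : ℕ → ℝ} (k : ℕ)
    (hw : ∀ n : ℕ, |w n| ≤ ((n : ℝ) + 1) ^ k) : Summable fun n => ‖w n * coeff n b‖ := by
  refine Summable.of_nonneg_of_le (fun _ => norm_nonneg _) (fun n => ?_) (hb k)
  rw [norm_mul]
  exact mul_le_mul_of_nonneg_right (hw n) (abs_nonneg _)

lemma abs_choose_le (n i : ℕ) : |(n.choose i : ℝ)| ≤ ((n : ℝ) + 1) ^ i := by
  rw [abs_of_nonneg (by positivity)]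
  calc (n.choose i : ℝ) ≤ (n : ℝ) ^ i := by exact_mod_cast Nat.choose_le_pow n i
    _ ≤ _ := by gcongr; linarith

lemma HasMoments.summable_choose {b : ℝ⟦X⟧} (hb : HasMoments b) (i : ℕ) :
    Summable fun n : ℕ => ‖(n.choose i : ℝ) * coeff n b‖ :=
  hb.summable_of_le i fun n => abs_choose_le n i

lemma HasMoments.summable_abs {b : ℝ⟦X⟧} (hb : HasMoments b) :
    Summable fun n : ℕ => |coeff n b| := by
  simpa using hb 0

/-- The weight is submultiplicative: n + 1 ≤ (p + 1)(q + 1) when p + q = n. The Cauchy product of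
the two weighted series therefore dominates. -/
lemma HasMoments.mul {a b : ℝ⟦X⟧} (ha : HasMoments a) (hb : HasMoments b) :
    HasMoments (a * b) := by
  intro k
  have h := summable_norm_sum_mul_antidiagonal_of_summable_norm (ha k).norm (hb k).norm
  refine Summable.of_nonneg_of_le (fun _ => by positivity) (fun n => ?_) h
  rw [coeff_mul, Real.norm_of_nonneg (Finset.sum_nonneg fun _ _ => by positivity)]
  calc ((n : ℝ) + 1) ^ k * |∑ p ∈ Finset.HasAntidiagonal.antidiagonal n, coeff p.1 a * coeff p.2 b|
      ≤ ((n : ℝ) + 1) ^ k * ∑ p ∈ Finset.HasAntidiagonal.antidiagonal n, |coeff p.1 a * coeff p.2 b| := by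
        gcongr; exact Finset.abs_sum_le_sum_abs _ _
    _ ≤ _ := by
        rw [Finset.mul_sum]
        refine Finset.sum_le_sum fun p hp => ?_
        have hn : (n : ℝ) = p.1 + p.2 := by
          rw [← Finset.HasAntidiagonal.mem_antidiagonal.1 hp]; push_cast; rfl
        rw [abs_mul, hn]
        have : ((p.1 : ℝ) + p.2 + 1) ^ k ≤ ((p.1 : ℝ) + 1) ^ k * ((p.2 : ℝ) + 1) ^ k := by
          rw [← mul_pow]
          gcongr
          nlinarith [(Nat.cast_nonneg p.1 : (0 : ℝ) ≤ p.1), (Nat.cast_nonneg p.2 : (0 : ℝ) ≤ p.2),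
            mul_nonneg (Nat.cast_nonneg p.1 : (0 : ℝ) ≤ p.1) (Nat.cast_nonneg p.2 : (0 : ℝ) ≤ p.2)]
        calc _ ≤ ((p.1 : ℝ) + 1) ^ k * ((p.2 : ℝ) + 1) ^ k * (|coeff p.1 a| * |coeff p.2 b|) := by
              gcongr
          _ = _ := by ring

lemma HasMoments.sub {a b : ℝ⟦X⟧} (ha : HasMoments a) (hb : HasMoments b) :
    HasMoments (a - b) := by
  intro k
  refine Summable.of_nonneg_of_le (fun _ => by positivity) (fun n => ?_) ((ha k).add (hb k))
  rw [map_sub, ← mul_add]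
  gcongr
  exact abs_sub _ _

lemma hasMoments_X : HasMoments X := by
  intro k
  refine summable_of_ne_finset_zero (s := {1}) fun n hn => ?_
  rw [coeff_X, if_neg (by simpa using hn)]
  simp

lemma HasMoments.X_sub_one_mul {b : ℝ⟦X⟧} (hb : HasMoments b) : HasMoments ((X - 1) * b) := by
  rw [sub_mul, one_mul]
  exact (hasMoments_X.mul hb).sub hb

lemma HasMoments.X_sub_one_pow_mul {b : ℝ⟦X⟧} (hb : HasMoments b) (r : ℕ) :
    HasMoments ((X - 1) ^ r * b) := by
  induction r with
  | zero => simpa using hb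
  | succ r ih => rw [pow_succ', mul_assoc]; exact ih.X_sub_one_mul

lemma HasMoments.derivative {b : ℝ⟦X⟧} (hb : HasMoments b) : HasMoments (d⁄dX ℝ b) := by
  intro k
  refine Summable.of_nonneg_of_le (fun _ => by positivity) (fun n => ?_)
    ((summable_nat_add_iff 1).2 (hb (k + 1)))
  rw [coeff_derivative, abs_mul, abs_of_nonneg (by positivity : (0 : ℝ) ≤ (n : ℝ) + 1)]
  push_cast
  calc ((n : ℝ) + 1) ^ k * (|coeff (n + 1) b| * ((n : ℝ) + 1))
      = ((n : ℝ) + 1) ^ (k + 1) * |coeff (n + 1) b| := by ring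
    _ ≤ _ := by gcongr; linarith

lemma HasMoments.iterate_derivative {b : ℝ⟦X⟧} (hb : HasMoments b) (k : ℕ) :
    HasMoments ((d⁄dX ℝ)^[k] b) := by
  induction k with
  | zero => exact hb
  | succ k ih => rw [Function.iterate_succ_apply']; exact ih.derivative

lemma HasMoments.X_pow_mul {b : ℝ⟦X⟧} (hb : HasMoments b) (k : ℕ) : HasMoments (X ^ k * b) := by
  induction k with
  | zero => simpa using hb
  | succ r ih => rw [pow_succ', mul_assoc]; exact hasMoments_X.mul ih

lemma coeff_recenter (b : ℝ⟦X⟧) (i : ℕ) :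
    coeff i (recenter b) = ∑' n : ℕ, (n.choose i : ℝ) * coeff n b := coeff_mk _ _

/-- The Vandermonde convolution of C(p + q, i), combined with the absolutely convergent Cauchy
product. -/
lemma recenter_mul {a b : ℝ⟦X⟧} (ha : HasMoments a) (hb : HasMoments b) :
    recenter (a * b) = recenter a * recenter b := by
  ext i
  rw [coeff_mul, coeff_recenter]
  simp_rw [coeff_recenter]
  have h1 : ∀ p : ℕ × ℕ, (∑' n : ℕ, (n.choose p.1 : ℝ) * coeff n a) *
      (∑' n : ℕ, (n.choose p.2 : ℝ) * coeff n b) = ∑' n : ℕ, ∑ q ∈ Finset.HasAntidiagonal.antidiagonal n,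
        ((q.1.choose p.1 : ℝ) * coeff q.1 a) * ((q.2.choose p.2 : ℝ) * coeff q.2 b) := fun p =>
    tsum_mul_tsum_eq_tsum_sum_antidiagonal_of_summable_norm (ha.summable_choose _)
      (hb.summable_choose _)
  simp_rw [h1]
  rw [← Summable.tsum_finsetSum]
  · refine tsum_congr fun n => ?_
    rw [Finset.sum_comm, coeff_mul, Finset.mul_sum]
    refine Finset.sum_congr rfl fun q hq => ?_
    rw [← Finset.HasAntidiagonal.mem_antidiagonal.1 hq, Nat.add_choose_eq]
    push_cast
    rw [Finset.sum_mul]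
    exact Finset.sum_congr rfl fun p _ => by ring
  · exact fun p _ => (summable_norm_sum_mul_antidiagonal_of_summable_norm (ha.summable_choose p.1)
      (hb.summable_choose p.2)).of_norm

lemma recenter_sub {a b : ℝ⟦X⟧} (ha : HasMoments a) (hb : HasMoments b) :
    recenter (a - b) = recenter a - recenter b := by
  ext i
  rw [map_sub, coeff_recenter, coeff_recenter, coeff_recenter,
    ← (ha.summable_choose i).of_norm.tsum_sub (hb.summable_choose i).of_norm]
  exact tsum_congr fun n => by rw [map_sub]; ring

lemma recenter_X : recenter X = 1 + X := by
  ext i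
  rw [coeff_recenter, tsum_eq_single 1 fun n hn => by rw [coeff_X, if_neg hn, mul_zero]]
  rcases i with _ | _ | i <;> simp [coeff_X, coeff_one, Nat.choose_eq_zero_of_lt]

lemma recenter_X_sub_one_pow_mul {b : ℝ⟦X⟧} (hb : HasMoments b) (r : ℕ) :
    recenter ((X - 1) ^ r * b) = X ^ r * recenter b := by
  induction r with
  | zero => simp
  | succ r ih =>
    have h := hb.X_sub_one_pow_mul r
    rw [pow_succ', mul_assoc, sub_mul, one_mul, recenter_sub (hasMoments_X.mul h) h,
      recenter_mul hasMoments_X h, recenter_X, ih]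
    ring

lemma recenter_X_pow_mul {b : ℝ⟦X⟧} (hb : HasMoments b) (r : ℕ) :
    recenter (X ^ r * b) = (1 + X) ^ r * recenter b := by
  induction r with
  | zero => simp
  | succ r ih =>
    rw [pow_succ', mul_assoc, recenter_mul hasMoments_X (hb.X_pow_mul r), recenter_X, ih]
    ring

lemma recenter_derivative {b : ℝ⟦X⟧} (hb : HasMoments b) :
    recenter (d⁄dX ℝ b) = d⁄dX ℝ (recenter b) := by
  ext i
  rw [coeff_derivative, coeff_recenter, coeff_recenter, ← tsum_mul_right,
    ((hb.summable_choose (i + 1)).of_norm.mul_right _).tsum_eq_zero_add]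
  simp only [Nat.choose_zero_succ, Nat.cast_zero, zero_mul, zero_add]
  refine tsum_congr fun n => ?_
  rw [coeff_derivative]
  have := congrArg (Nat.cast (R := ℝ)) (Nat.add_one_mul_choose_eq n i)
  push_cast at this
  linear_combination (coeff (n + 1) b) * this

lemma recenter_iterate_derivative {b : ℝ⟦X⟧} (hb : HasMoments b) (k : ℕ) :
    recenter ((d⁄dX ℝ)^[k] b) = (d⁄dX ℝ)^[k] (recenter b) := by
  induction k with
  | zero => rfl
  | succ k ih =>
    rw [Function.iterate_succ_apply', recenter_derivative (hb.iterate_derivative k), ih,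
      Function.iterate_succ_apply']

/-- The operator X^k ∂^k is diagonal on monomials with falling factorials as eigenvalues. For this
reason falling factorials, not powers, are the statistics computed exactly. -/
lemma coeff_X_pow_mul_iterate_derivative (b : ℝ⟦X⟧) (k n : ℕ) :
    coeff n (X ^ k * (d⁄dX ℝ)^[k] b) = (n.descFactorial k : ℝ) * coeff n b := by
  rw [coeff_X_pow_mul']
  split_ifs with h
  · rw [coeff_iterate_derivative, Nat.sub_add_cancel h]
    congr 2
    rw [Nat.ascFactorial_eq_factorial_mul_choose', Nat.descFactorial_eq_factorial_mul_choose,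
      show n - k + 1 + k - 1 = n by omega]
  · rw [Nat.descFactorial_of_lt (not_le.1 h)]; simp

/-- The pairing of `C(·, i)` with the coefficients of `b`, weighted by falling factorials. -/
lemma tsum_choose_mul_descFactorial {b : ℝ⟦X⟧} (hb : HasMoments b) (i k : ℕ) :
    ∑' n : ℕ, (n.choose i : ℝ) * ((n.descFactorial k : ℝ) * coeff n b) =
      coeff i ((1 + X) ^ k * (d⁄dX ℝ)^[k] (recenter b)) := by
  rw [← recenter_iterate_derivative hb, ← recenter_X_pow_mul (hb.iterate_derivative k),
    coeff_recenter]
  exact tsum_congr fun n => by rw [coeff_X_pow_mul_iterate_derivative]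

/-- The value at `u` of the power series with coefficients `b`. -/
noncomputable def evalAt (u : ℂ) (b : ℝ⟦X⟧) : ℂ := ∑' n : ℕ, ((coeff n b : ℝ) : ℂ) * u ^ n

lemma HasMoments.summable_norm_eval {b : ℝ⟦X⟧} (hb : HasMoments b) {u : ℂ} (hu : ‖u‖ = 1) :
    Summable fun n : ℕ => ‖((coeff n b : ℝ) : ℂ) * u ^ n‖ := by
  simpa [hu] using hb.summable_abs

lemma evalAt_mul {a b : ℝ⟦X⟧} (ha : HasMoments a) (hb : HasMoments b) {u : ℂ} (hu : ‖u‖ = 1) :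
    evalAt u (a * b) = evalAt u a * evalAt u b := by
  rw [evalAt, evalAt, evalAt, tsum_mul_tsum_eq_tsum_sum_antidiagonal_of_summable_norm
    (ha.summable_norm_eval hu) (hb.summable_norm_eval hu)]
  refine tsum_congr fun n => ?_
  rw [coeff_mul]
  push_cast
  rw [Finset.sum_mul]
  refine Finset.sum_congr rfl fun p hp => ?_
  rw [← Finset.HasAntidiagonal.mem_antidiagonal.1 hp]
  ring

lemma evalAt_X_sub_one_pow_mul {b : ℝ⟦X⟧} (hb : HasMoments b) {u : ℂ} (hu : ‖u‖ = 1) (r : ℕ) :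
    evalAt u ((X - 1) ^ r * b) = (u - 1) ^ r * evalAt u b := by
  induction r with
  | zero => simp
  | succ r ih =>
    have h := hb.X_sub_one_pow_mul r
    have hX : evalAt u X = u := by
      rw [evalAt, tsum_eq_single 1 fun n hn => by rw [coeff_X, if_neg hn]; simp]
      simp
    have hs : evalAt u (X * ((X - 1) ^ r * b) - (X - 1) ^ r * b) =
        evalAt u (X * ((X - 1) ^ r * b)) - evalAt u ((X - 1) ^ r * b) := by
      rw [evalAt, evalAt, evalAt,
        ← ((hasMoments_X.mul h).summable_norm_eval hu).of_norm.tsum_sub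
          (h.summable_norm_eval hu).of_norm]
      exact tsum_congr fun n => by rw [map_sub]; push_cast; ring
    rw [pow_succ', mul_assoc, sub_mul, one_mul, hs, evalAt_mul hasMoments_X h hu, hX, ih]
    ring

/-! ### The Poisson and geometric factors of the symbol -/

/-- The Taylor coefficients at `0` of `exp (c (u - 1))`. -/
noncomputable def poissonSeries (c : ℝ) : ℝ⟦X⟧ :=
  mk fun n => Real.exp (-c) * (c ^ n / n.factorial)

/-- The Taylor coefficients at `0` of `1 / (1 - α (u - 1))`. -/
noncomputable def geomSeries (α : ℝ) : ℝ⟦X⟧ := mk fun n => (1 + α)⁻¹ * (α / (1 + α)) ^ n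

/-- The Taylor coefficients at `0` of `exp (c x)`. -/
noncomputable def expSeries (c : ℝ) : ℝ⟦X⟧ := mk fun n => c ^ n / n.factorial

/-- The Taylor coefficients at `0` of `1 / (1 - α x)`. -/
noncomputable def powSeries (α : ℝ) : ℝ⟦X⟧ := mk fun n => α ^ n

lemma hasMoments_poissonSeries {c : ℝ} (hc : 0 ≤ c) : HasMoments (poissonSeries c) := by
  intro k
  -- A polynomial weight costs at most a factor e^n, which only changes the exponential series'
  -- parameter from c to e·c.
  have h1 : ∀ n : ℕ, ((n : ℝ) + 1) ^ k ≤ k.factorial * (Real.exp 1 * Real.exp 1 ^ n) := fun n => by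
    have := Real.pow_div_factorial_le_exp ((n : ℝ) + 1) (by positivity) k
    rw [div_le_iff₀ (by positivity), Real.exp_add, ← Real.exp_one_pow] at this
    linarith
  refine Summable.of_nonneg_of_le (fun _ => by positivity) (fun n => ?_)
    ((Real.summable_pow_div_factorial (Real.exp 1 * c)).mul_left
      (k.factorial * Real.exp 1 * Real.exp (-c)))
  rw [poissonSeries, coeff_mk, abs_of_nonneg (by positivity)]
  calc _ ≤ k.factorial * (Real.exp 1 * Real.exp 1 ^ n) *
        (Real.exp (-c) * (c ^ n / n.factorial)) := by gcongr; exact h1 n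
    _ = _ := by rw [mul_pow]; ring

lemma div_one_add_lt_one {α : ℝ} (hα : 0 ≤ α) : ‖α / (1 + α)‖ < 1 := by
  rw [Real.norm_of_nonneg (by positivity), div_lt_one (by positivity)]
  linarith

lemma hasMoments_geomSeries {α : ℝ} (hα : 0 ≤ α) : HasMoments (geomSeries α) := by
  intro k
  have h := (summable_nat_add_iff 1).2
    (summable_norm_pow_mul_geometric_of_norm_lt_one k (div_one_add_lt_one hα))
  by_cases h0 : α = 0
  · refine summable_of_ne_finset_zero (s := {0}) fun n hn => ?_
    rw [geomSeries, coeff_mk, h0, zero_div, zero_pow (by simpa using hn)]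
    simp
  have hp : 0 < α / (1 + α) := by positivity
  refine (h.mul_left ((1 + α)⁻¹ * (α / (1 + α))⁻¹)).congr fun n => ?_
  rw [geomSeries, coeff_mk, abs_of_nonneg (by positivity), Real.norm_of_nonneg (by positivity)]
  rw [pow_succ (α / (1 + α)) n]
  push_cast
  field_simp

/-- Terms with n < i vanish; after the shift the closed forms of the exponential and negative
binomial series apply. -/
lemma tsum_choose_mul_eq (f : ℕ → ℝ) (i : ℕ) :
    ∑' n : ℕ, (n.choose i : ℝ) * f n = ∑' n : ℕ, ((n + i).choose i : ℝ) * f (n + i) := by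
  refine ((add_left_injective i).tsum_eq (f := fun n : ℕ => (n.choose i : ℝ) * f n) ?_).symm
  intro n hn
  by_contra h
  refine hn ?_
  simp only [Set.mem_range, not_exists] at h
  have : n < i := by
    by_contra h'
    exact h (n - i) (Nat.sub_add_cancel (not_lt.1 h'))
  simp [Nat.choose_eq_zero_of_lt this]

lemma recenter_poissonSeries (c : ℝ) : recenter (poissonSeries c) = expSeries c := by
  ext i
  rw [coeff_recenter, expSeries, coeff_mk, tsum_choose_mul_eq]
  have : ∀ n : ℕ, ((n + i).choose i : ℝ) * coeff (n + i) (poissonSeries c) =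
      Real.exp (-c) * (c ^ i / i.factorial) * (c ^ n / n.factorial) := fun n => by
    rw [poissonSeries, coeff_mk, add_comm n i, Nat.cast_add_choose ℝ]
    have := Nat.factorial_ne_zero (i + n)
    field_simp
    ring
  simp_rw [this]
  rw [tsum_mul_left]
  have h2 : ∑' n : ℕ, c ^ n / (n.factorial : ℝ) = Real.exp c := by
    rw [Real.exp_eq_exp_ℝ, NormedSpace.exp_eq_tsum_div]
  rw [h2, Real.exp_neg]
  field_simp

lemma recenter_geomSeries {α : ℝ} (hα : 0 ≤ α) : recenter (geomSeries α) = powSeries α := by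
  ext i
  rw [coeff_recenter, powSeries, coeff_mk, tsum_choose_mul_eq]
  have : ∀ n : ℕ, ((n + i).choose i : ℝ) * coeff (n + i) (geomSeries α) =
      (1 + α)⁻¹ * (α / (1 + α)) ^ i * (((n + i).choose i : ℝ) * (α / (1 + α)) ^ n) := fun n => by
    rw [geomSeries, coeff_mk]
    ring
  simp_rw [this]
  rw [tsum_mul_left, tsum_choose_mul_geometric_of_norm_lt_one i (div_one_add_lt_one hα)]
  have : 1 - α / (1 + α) = (1 + α)⁻¹ := by field_simp; ring
  rw [this, div_pow, inv_pow, one_div, inv_inv, pow_succ]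
  field_simp

lemma evalAt_poissonSeries (c : ℝ) (u : ℂ) :
    evalAt u (poissonSeries c) = Complex.exp (c * (u - 1)) := by
  have h2 : ∑' n : ℕ, ((c : ℂ) * u) ^ n / (n.factorial : ℂ) = Complex.exp (c * u) := by
    rw [Complex.exp_eq_exp_ℂ, NormedSpace.exp_eq_tsum_div]
  rw [evalAt, mul_sub, mul_one, sub_eq_neg_add, Complex.exp_add, ← h2, ← tsum_mul_left]
  refine tsum_congr fun n => ?_
  rw [poissonSeries, coeff_mk]
  push_cast
  ring

lemma evalAt_geomSeries {α : ℝ} (hα : 0 ≤ α) {u : ℂ} (hu : ‖u‖ = 1) :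
    evalAt u (geomSeries α) = 1 / (1 - α * (u - 1)) := by
  have h1 : ‖((α / (1 + α) : ℝ) : ℂ) * u‖ < 1 := by
    rw [norm_mul, hu, mul_one, Complex.norm_real]
    exact div_one_add_lt_one hα
  have h2 : ∀ n : ℕ, ((coeff n (geomSeries α) : ℝ) : ℂ) * u ^ n =
      (1 + α : ℂ)⁻¹ * (((α / (1 + α) : ℝ) : ℂ) * u) ^ n := fun n => by
    rw [geomSeries, coeff_mk]
    push_cast
    ring
  have h3 : (1 + α : ℂ) ≠ 0 := by
    norm_cast
    positivity
  simp_rw [evalAt, h2]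
  rw [tsum_mul_left, tsum_geometric_of_norm_lt_one h1, ← mul_inv, one_div]
  congr 1
  push_cast
  field_simp
  ring

/-- The Taylor coefficients at `0` of `exp (c (u - 1)) / (1 - α (u - 1))`. -/
noncomputable def symbolSeries (c α : ℝ) : ℝ⟦X⟧ := poissonSeries c * geomSeries α

lemma hasMoments_symbolSeries {c α : ℝ} (hc : 0 ≤ c) (hα : 0 ≤ α) :
    HasMoments (symbolSeries c α) :=
  (hasMoments_poissonSeries hc).mul (hasMoments_geomSeries hα)

lemma recenter_symbolSeries {c α : ℝ} (hc : 0 ≤ c) (hα : 0 ≤ α) :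
    recenter (symbolSeries c α) = expSeries c * powSeries α := by
  rw [symbolSeries, recenter_mul (hasMoments_poissonSeries hc) (hasMoments_geomSeries hα),
    recenter_poissonSeries, recenter_geomSeries hα]

lemma evalAt_symbolSeries {c α : ℝ} (hc : 0 ≤ c) (hα : 0 ≤ α) {u : ℂ} (hu : ‖u‖ = 1) :
    evalAt u (symbolSeries c α) =
      Complex.exp (c * (u - 1)) * (1 / (1 - α * (u - 1))) := by
  rw [symbolSeries, evalAt_mul (hasMoments_poissonSeries hc) (hasMoments_geomSeries hα) hu,
    evalAt_poissonSeries, evalAt_geomSeries hα hu]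

end DiscreteBBP

/-! ### Rational Schur functions: removing the singularity, and the value at 1 -/

namespace DiscreteBBP

section Reduction
open Polynomial

/-- The reduction of `(1 + X) ^ n` modulo `∏ i, (X - x i)`. -/
noncomputable def reducedPow {N : ℕ} (x : Fin N → ℂ) : ℕ → ℂ[X]
  | 0 => 1
  | n + 1 => reducedPow x n * (X + 1) - C ((reducedPow x n).coeff (N - 1)) * ∏ i, (X - C (x i))

lemma natDegree_prod_X_sub {N : ℕ} (x : Fin N → ℂ) : (∏ i, (X - C (x i))).natDegree = N := by
  rw [natDegree_prod_of_monic _ _ fun i _ => monic_X_sub_C _]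
  simp

lemma coeff_mul_X_add_one (p : ℂ[X]) (a : ℕ) :
    (p * (X + 1)).coeff (a + 1) = p.coeff a + p.coeff (a + 1) := by
  rw [mul_add, mul_one, coeff_add, coeff_mul_X]

/-- Multiplication by X + 1 raises the degree to at most N, and the subtracted multiple of the monic
modulus cancels the coefficient of X^N. -/
lemma natDegree_reducedPow_lt {N : ℕ} (hN : 0 < N) (x : Fin N → ℂ) (n : ℕ) :
    (reducedPow x n).natDegree < N := by
  have hmonic : (∏ i, (X - C (x i))).coeff N = 1 := by
    have h : (∏ i, (X - C (x i))).Monic := monic_prod_of_monic _ _ fun i _ => monic_X_sub_C _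
    rw [← h.coeff_natDegree, natDegree_prod_X_sub]
  induction n with
  | zero => simpa [reducedPow] using hN
  | succ n ih =>
    obtain ⟨M, rfl⟩ : ∃ M, N = M + 1 := ⟨N - 1, by omega⟩
    rw [Nat.lt_succ_iff, natDegree_le_iff_coeff_eq_zero]
    intro a ha
    obtain ⟨b, rfl⟩ : ∃ b, a = b + 1 := ⟨a - 1, by omega⟩
    rw [reducedPow, coeff_sub, coeff_mul_X_add_one, coeff_C_mul,
      coeff_eq_zero_of_natDegree_lt (n := b + 1) (by omega)]
    rcases Nat.lt_succ_iff_lt_or_eq.1 ha with h | h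
    · rw [coeff_eq_zero_of_natDegree_lt (n := b) (by omega),
        coeff_eq_zero_of_natDegree_lt (n := b + 1) (by rw [natDegree_prod_X_sub]; omega)]
      simp
    · obtain rfl : M = b := by omega
      rw [hmonic]
      simp

lemma eval_reducedPow {N : ℕ} (x : Fin N → ℂ) (n : ℕ) (i : Fin N) :
    (reducedPow x n).eval (x i) = (x i + 1) ^ n := by
  induction n with
  | zero => simp [reducedPow]
  | succ n ih =>
    have : (∏ j, (X - C (x j))).eval (x i) = 0 := by
      rw [eval_prod]
      exact Finset.prod_eq_zero (Finset.mem_univ i) (by simp)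
    rw [reducedPow, eval_sub, eval_mul, eval_mul, this, ih]
    simp [pow_succ]

lemma continuous_coeff_prod_X_sub {N : ℕ} (s : Finset (Fin N)) (a : ℕ) :
    Continuous fun x : Fin N → ℂ => (∏ i ∈ s, (X - C (x i))).coeff a := by
  classical
  induction s using Finset.induction_on generalizing a with
  | empty => simpa using continuous_const
  | insert i s hi ih =>
    simp_rw [Finset.prod_insert hi, sub_mul, coeff_sub, coeff_C_mul]
    cases a with
    | zero =>
      simp only [mul_coeff_zero, coeff_X_zero, zero_mul, zero_sub]
      exact ((continuous_apply i).mul (ih 0)).neg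
    | succ a =>
      simp_rw [coeff_X_mul]
      exact (ih a).sub ((continuous_apply i).mul (ih _))

lemma continuous_coeff_reducedPow {N : ℕ} (n a : ℕ) :
    Continuous fun x : Fin N → ℂ => (reducedPow x n).coeff a := by
  induction n generalizing a with
  | zero => simpa [reducedPow] using continuous_const
  | succ n ih =>
    simp_rw [reducedPow, coeff_sub, coeff_C_mul]
    refine Continuous.sub ?_ ((ih _).mul (continuous_coeff_prod_X_sub _ _))
    cases a with
    | zero => simpa [mul_add] using ih 0
    | succ a => simp_rw [coeff_mul_X_add_one]; exact (ih a).add (ih _)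

/-- At x = 0 the modulus is X^N, so reduction is truncation of the binomial expansion. -/
lemma coeff_reducedPow_zero {N : ℕ} (n a : ℕ) (ha : a < N) :
    (reducedPow (0 : Fin N → ℂ) n).coeff a = n.choose a := by
  induction n generalizing a with
  | zero => rcases a with _ | a <;> simp [reducedPow, coeff_one]
  | succ n ih =>
    have h0 : (∏ i : Fin N, (X - C ((0 : Fin N → ℂ) i))).coeff a = 0 := by
      simp [coeff_X_pow, ha.ne]
    rw [reducedPow, coeff_sub, coeff_C_mul, h0, mul_zero, sub_zero]
    cases a with
    | zero => simpa [mul_add] using ih 0 ha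
    | succ a =>
      rw [coeff_mul_X_add_one, ih a (by omega), ih _ ha, Nat.choose_succ_succ]
      push_cast
      rfl

/-- Each power u_i^n is the value at x_i = u_i - 1 of a polynomial of degree below N, so the
alternant matrix factors through the Vandermonde matrix. The cofactor depends continuously on u,
which gives the extension to coinciding arguments. -/
lemma det_pow_eq {N : ℕ} (hN : 0 < N) (n : Fin N → ℕ) (u : Fin N → ℂ) :
    (Matrix.of fun i j => u i ^ n j).det = (Matrix.vandermonde u).det *
      (Matrix.of fun a j : Fin N => (reducedPow (fun i => u i - 1) (n j)).coeff a).det := by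
  rw [← Matrix.det_vandermonde_sub u 1, ← Matrix.det_mul]
  congr 1
  ext i j
  rw [Matrix.mul_apply, Matrix.of_apply]
  have h := eval_reducedPow (fun i => u i - 1) (n j) i
  rw [eval_eq_sum_range' (natDegree_reducedPow_lt hN _ _), Finset.sum_range] at h
  simp only [sub_add_cancel] at h
  rw [← h]
  exact Finset.sum_congr rfl fun a _ => by rw [Matrix.vandermonde_apply, Matrix.of_apply, mul_comm]

end Reduction

/-- The sign relating `∏_{i<j} (u_i - u_j)` to the Vandermonde determinant. -/
def vandermondeSign (N : ℕ) : ℤ := ∏ i : Fin N, ∏ _j ∈ Finset.Ioi i, (-1)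

lemma vandermondeSign_mul_self (N : ℕ) : vandermondeSign N * vandermondeSign N = 1 := by
  rw [vandermondeSign, ← Finset.prod_mul_distrib]
  refine Finset.prod_eq_one fun i _ => ?_
  rw [← Finset.prod_mul_distrib]
  simp

lemma prod_sub_eq {N : ℕ} (u : Fin N → ℂ) : ∏ i : Fin N, ∏ j ∈ Finset.Ioi i, (u i - u j) =
    (vandermondeSign N : ℂ) * (Matrix.vandermonde u).det := by
  rw [Matrix.det_vandermonde, vandermondeSign]
  push_cast
  rw [← Finset.prod_mul_distrib]
  refine Finset.prod_congr rfl fun i _ => ?_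
  rw [← Finset.prod_mul_distrib]
  exact Finset.prod_congr rfl fun j _ => by ring

/-- Twisting by a power of the determinant character makes all exponents natural numbers. -/
lemma Signature.exists_shift {N : ℕ} (l : Signature N) :
    ∃ (c : ℕ) (n : Fin N → ℕ), ∀ j, (n j : ℤ) = l.shifted j + c := by
  refine ⟨∑ j, (l.shifted j).natAbs, fun j => (l.shifted j + ∑ j, (l.shifted j).natAbs).toNat,
    fun j => ?_⟩
  have h := Finset.single_le_sum (f := fun j => (l.shifted j).natAbs) (fun _ _ => Nat.zero_le _)
    (Finset.mem_univ j)
  rw [Int.toNat_of_nonneg]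
  zify at h
  have := neg_abs_le (l.shifted j)
  push_cast
  linarith

lemma Signature.shifted_strictAnti {N : ℕ} (l : Signature N) : StrictAnti l.shifted := by
  intro i j hij
  have h1 := l.2 hij.le
  have h2 : (i : ℕ) < j := hij
  simp only [Signature.shifted]
  omega

lemma alternantRatio_eq {N : ℕ} (hN : 0 < N) (l : Signature N) {c : ℕ} {n : Fin N → ℕ}
    (hn : ∀ j, (n j : ℤ) = l.shifted j + c) {u : Fin N → ℂ} (hu : Function.Injective u)
    (hu0 : ∀ i, u i ≠ 0) :
    alternantRatio l u = (∏ i, (u i ^ c)⁻¹) * ((vandermondeSign N : ℂ) *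
      (Matrix.of fun a j : Fin N =>
        (reducedPow (fun i => u i - 1) (n j)).coeff a).det) := by
  have h1 : (Matrix.of fun i j : Fin N => u i ^ l.shifted j).det =
      (∏ i, (u i ^ c)⁻¹) * (Matrix.of fun i j => u i ^ n j).det := by
    rw [← Matrix.det_mul_column]
    congr 1
    ext i j
    have : l.shifted j = (n j : ℤ) - (c : ℤ) := by rw [hn]; ring
    rw [Matrix.of_apply, Matrix.of_apply, Matrix.of_apply, this, zpow_sub₀ (hu0 i), zpow_natCast,
      zpow_natCast, div_eq_inv_mul]
  have hV := Matrix.det_vandermonde_ne_zero_iff.2 hu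
  have he : (vandermondeSign N : ℂ) * vandermondeSign N = 1 := by
    exact_mod_cast vandermondeSign_mul_self N
  have he0 : (vandermondeSign N : ℂ) ≠ 0 := left_ne_zero_of_mul_eq_one he
  rw [alternantRatio, h1, det_pow_eq hN, prod_sub_eq, div_eq_iff (mul_ne_zero he0 hV)]
  linear_combination (-(∏ i, (u i ^ c)⁻¹) * (Matrix.vandermonde u).det *
    (Matrix.of fun a j : Fin N => (reducedPow (fun i => u i - 1) (n j)).coeff a).det) * he

lemma schurFun_eq {N : ℕ} (hN : 0 < N) (l : Signature N) {c : ℕ} {n : Fin N → ℕ}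
    (hn : ∀ j, (n j : ℤ) = l.shifted j + c) {u : Fin N → ℂ}
    (hu : u ∈ closure {u : Fin N → ℂ | Function.Injective u}) (hu0 : ∀ i, u i ≠ 0) :
    schurFun l u = (∏ i, (u i ^ c)⁻¹) * ((vandermondeSign N : ℂ) *
      (Matrix.of fun a j : Fin N =>
        (reducedPow (fun i => u i - 1) (n j)).coeff a).det) := by
  refine extendFrom_eq hu ?_
  have hcont : ContinuousAt (fun u : Fin N → ℂ => (∏ i, (u i ^ c)⁻¹) *
      ((vandermondeSign N : ℂ) * (Matrix.of fun a j : Fin N =>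
        (reducedPow (fun i => u i - 1) (n j)).coeff a).det)) u := by
    refine ContinuousAt.mul ?_ (Continuous.continuousAt ?_)
    · refine tendsto_finsetProd _ fun i _ => ?_
      exact (((continuous_apply i).pow c).continuousAt).inv₀ (pow_ne_zero _ (hu0 i))
    · refine continuous_const.mul (Continuous.matrix_det ?_)
      refine continuous_matrix fun a j => ?_
      exact (continuous_coeff_reducedPow (n j) a).comp (by fun_prop)
  refine (hcont.tendsto.mono_left nhdsWithin_le_nhds).congr' ?_
  have h0 : ∀ᶠ v in 𝓝[{u : Fin N → ℂ | Function.Injective u}] u, ∀ i, v i ≠ 0 := by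
    refine nhdsWithin_le_nhds (eventually_all.2 fun i => ?_)
    exact (continuous_apply i).continuousAt.eventually_ne (hu0 i)
  filter_upwards [h0, self_mem_nhdsWithin] with v hv hv'
  exact (alternantRatio_eq hN l hn hv' hv).symm

lemma schurFun_of_injective {N : ℕ} (hN : 0 < N) (l : Signature N) {u : Fin N → ℂ}
    (hu : Function.Injective u) (hu0 : ∀ i, u i ≠ 0) : schurFun l u = alternantRatio l u := by
  obtain ⟨c, n, hn⟩ := l.exists_shift
  rw [schurFun_eq hN l hn (subset_closure hu) hu0, alternantRatio_eq hN l hn hu hu0]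

lemma one_mem_closure_injective (N : ℕ) :
    (1 : Fin N → ℂ) ∈ closure {u : Fin N → ℂ | Function.Injective u} := by
  have h : Tendsto (fun (m : ℕ) (i : Fin N) => (1 : ℂ) + (i : ℕ) * (1 / ((m : ℂ) + 1))) atTop
      (𝓝 (1 : Fin N → ℂ)) := by
    rw [tendsto_pi_nhds]
    intro i
    simpa using ((tendsto_one_div_add_atTop_nhds_zero_nat (𝕜 := ℂ)).const_mul
      (((i : ℕ) : ℂ))).const_add 1
  refine mem_closure_of_tendsto h (Eventually.of_forall fun m i j hij => ?_)
  have hm : (1 / ((m : ℂ) + 1)) ≠ 0 := one_div_ne_zero (by exact_mod_cast Nat.succ_ne_zero m)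
  have := mul_right_cancel₀ hm (add_left_cancel hij)
  exact Fin.ext (by exact_mod_cast this)

lemma schurFun_one {N : ℕ} (hN : 0 < N) (l : Signature N) {c : ℕ} {n : Fin N → ℕ}
    (hn : ∀ j, (n j : ℤ) = l.shifted j + c) :
    schurFun l 1 = ((vandermondeSign N *
      (Matrix.of fun i j : Fin N => ((n i).choose j : ℤ)).det : ℤ) : ℂ) := by
  rw [schurFun_eq hN l hn (one_mem_closure_injective N) fun i => one_ne_zero, Int.cast_mul,
    ← Matrix.det_transpose]
  have h1 : (fun i : Fin N => (1 : Fin N → ℂ) i - 1) = 0 := by ext; simp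
  have h2 : (((Matrix.of fun i j : Fin N => ((n i).choose j : ℤ)).det : ℤ) : ℂ) =
      (Matrix.of fun i j : Fin N => ((n i).choose j : ℂ)).det := by
    rw [Int.cast_det]
    congr 1
  rw [h1, h2]
  simp only [Pi.one_apply, one_pow, inv_one, Finset.prod_const_one, one_mul]
  congr 2
  ext i j
  simp [coeff_reducedPow_zero _ _ j.2]

/-- Since j! C(x, j) is monic of degree j in x, the determinant times the product of the j! is the
Vandermonde determinant of the distinct n_i. -/
lemma det_choose_ne_zero {N : ℕ} {n : Fin N → ℕ} (hn : Function.Injective n) :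
    (Matrix.of fun i j : Fin N => ((n i).choose j : ℤ)).det ≠ 0 := by
  have h := Matrix.det_eval_matrixOfPolynomials_eq_det_vandermonde (fun i => (n i : ℤ))
    (fun i : Fin N => descPochhammer ℤ i) (fun i => descPochhammer_natDegree ℤ i)
    (fun i => monic_descPochhammer ℤ i)
  have h2 : (Matrix.of fun i j : Fin N => (descPochhammer ℤ j).eval (n i : ℤ)) =
      Matrix.of fun i j : Fin N => ((j : ℕ).factorial : ℤ) *
        (Matrix.of fun i j : Fin N => ((n i).choose j : ℤ)) i j := by
    ext i j
    rw [Matrix.of_apply, Matrix.of_apply, Matrix.of_apply,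
      descPochhammer_eval_eq_descFactorial ℤ, Nat.descFactorial_eq_factorial_mul_choose]
    push_cast
    rfl
  rw [h2, Matrix.det_mul_row] at h
  have hV : (Matrix.vandermonde fun i => (n i : ℤ)).det ≠ 0 :=
    Matrix.det_vandermonde_ne_zero_iff.2 fun i j hij => hn (by exact_mod_cast hij)
  rw [h] at hV
  exact right_ne_zero_of_mul hV

/-- The value is a nonzero integer. The bound lets ρ itself dominate the terms ρ(l)/χ^l(1) when sum
and integral are exchanged. -/
lemma one_le_norm_schurFun_one {N : ℕ} (hN : 0 < N) (l : Signature N) : 1 ≤ ‖schurFun l 1‖ := by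
  obtain ⟨c, n, hn⟩ := l.exists_shift
  have hinj : Function.Injective n := fun i j hij => l.shifted_strictAnti.injective (by
    have := hn i
    rw [hij, hn j] at this
    linarith)
  rw [schurFun_one hN l hn, Complex.norm_intCast]
  have h0 : vandermondeSign N * (Matrix.of fun i j : Fin N => ((n i).choose j : ℤ)).det ≠ 0 :=
    mul_ne_zero (left_ne_zero_of_mul_eq_one (vandermondeSign_mul_self N)) (det_choose_ne_zero hinj)
  exact_mod_cast Int.one_le_abs h0

end DiscreteBBP

/-! ### Fourier inversion on the torus and the biorthogonal form of the measure -/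

namespace DiscreteBBP
open PowerSeries

/-- The coefficient of a power series at an integer index, `0` at negative indices. -/
noncomputable def intCoeff (b : ℝ⟦X⟧) (m : ℤ) : ℝ := if 0 ≤ m then coeff m.toNat b else 0

lemma fourier_eq_zpow (n : ℤ) (x : UnitAddCircle) :
    fourier n x = (fourier 1 x : ℂ) ^ n := by
  rw [fourier_apply, fourier_one, AddCircle.toCircle_zsmul, Circle.coe_zpow]

lemma norm_fourier_apply (n : ℤ) (x : UnitAddCircle) : ‖(fourier n x : ℂ)‖ = 1 := by
  rw [fourier_apply, Circle.norm_coe]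

lemma volume_unitAddCircle :
    (volume : Measure UnitAddCircle) = AddCircle.haarAddCircle := by
  rw [AddCircle.volume_eq_smul_haarAddCircle, ENNReal.ofReal_one, one_smul]

instance : IsProbabilityMeasure (volume : Measure UnitAddCircle) := by
  rw [volume_unitAddCircle]
  infer_instance

lemma integral_fourier (n : ℤ) :
    ∫ x : UnitAddCircle, (fourier n x : ℂ) = if n = 0 then 1 else 0 := by
  have h := (orthonormal_iff_ite.mp <| orthonormal_fourier (T := (1 : ℝ))) 0 n
  simp only [ContinuousMap.inner_toLp, ← fourier_neg, ← fourier_add, neg_zero, add_zero] at h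
  rw [volume_unitAddCircle]
  exact h.trans (if_congr eq_comm rfl rfl)

lemma integral_mFourier {N : ℕ} (n : Fin N → ℤ) :
    ∫ t : UnitAddTorus (Fin N), UnitAddTorus.mFourier n t = if n = 0 then 1 else 0 := by
  simp only [UnitAddTorus.mFourier, ContinuousMap.coe_mk]
  rw [integral_fintype_prod_volume_eq_prod (fun i x => (fourier (n i) x : ℂ))]
  simp_rw [integral_fourier]
  split_ifs with h
  · simp [h]
  · obtain ⟨i, hi⟩ := Function.ne_iff.1 h
    exact Finset.prod_eq_zero (Finset.mem_univ i) (if_neg hi)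

lemma integral_fourier_mul_evalAt {b : ℝ⟦X⟧} (hb : HasMoments b) (m : ℤ) :
    ∫ x : UnitAddCircle, (fourier (-m) x : ℂ) * evalAt (fourier 1 x) b = intCoeff b m := by
  have h1 : ∀ x : UnitAddCircle, (fourier (-m) x : ℂ) * evalAt (fourier 1 x) b =
      ∑' n : ℕ, ((coeff n b : ℝ) : ℂ) * fourier ((n : ℤ) - m) x := fun x => by
    rw [evalAt, ← tsum_mul_left]
    refine tsum_congr fun n => ?_
    rw [sub_eq_add_neg, fourier_add, fourier_eq_zpow n, zpow_natCast]
    ring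
  simp_rw [h1]
  rw [← integral_tsum_of_summable_integral_norm]
  · simp_rw [integral_const_mul, integral_fourier]
    rw [intCoeff]
    split_ifs with hm
    · rw [tsum_eq_single m.toNat]
      · rw [if_pos (by omega)]; simp
      · intro n hn
        rw [if_neg (by omega), mul_zero]
    · rw [Complex.ofReal_zero]
      refine (tsum_congr fun n => ?_).trans tsum_zero
      rw [if_neg (by omega), mul_zero]
  · intro n
    exact (continuous_const.mul (ContinuousMap.continuous _)).integrable_of_hasCompactSupport
      (HasCompactSupport.of_compactSpace _)
  · refine hb.summable_abs.congr fun n => ?_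
    simp_rw [norm_mul, norm_fourier_apply, mul_one, Complex.norm_real]
    simp

/-- The alternant `det (u_i ^ l_j)` as a trigonometric polynomial. -/
noncomputable def trigAlternant {N : ℕ} (p : Fin N → ℤ) (t : UnitAddTorus (Fin N)) : ℂ :=
  ∑ σ : Equiv.Perm (Fin N), ((Equiv.Perm.sign σ : ℤ) : ℂ) * UnitAddTorus.mFourier (p ∘ σ) t

lemma trigAlternant_eq_det {N : ℕ} (p : Fin N → ℤ) (t : UnitAddTorus (Fin N)) :
    trigAlternant p t = (Matrix.of fun i j : Fin N => (fourier 1 (t i) : ℂ) ^ p j).det := by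
  rw [← Matrix.det_transpose, Matrix.det_apply', trigAlternant]
  refine Finset.sum_congr rfl fun σ _ => ?_
  congr 1
  simp only [UnitAddTorus.mFourier, ContinuousMap.coe_mk, Matrix.transpose_apply, Matrix.of_apply,
    Function.comp_apply]
  exact Finset.prod_congr rfl fun i _ => fourier_eq_zpow _ _

lemma norm_trigAlternant_le {N : ℕ} (p : Fin N → ℤ) (t : UnitAddTorus (Fin N)) :
    ‖trigAlternant p t‖ ≤ (Fintype.card (Equiv.Perm (Fin N)) : ℝ) := by
  refine (norm_sum_le _ _).trans (le_of_eq ?_)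
  rw [Finset.sum_congr rfl fun σ _ => ?_, Finset.sum_const, Finset.card_univ, nsmul_one]
  rw [norm_mul]
  simp only [UnitAddTorus.mFourier, ContinuousMap.coe_mk, norm_prod, norm_fourier_apply,
    Finset.prod_const_one, mul_one]
  rcases Int.units_eq_one_or (Equiv.Perm.sign σ) with h | h <;> simp [h]

lemma continuous_trigAlternant {N : ℕ} (p : Fin N → ℤ) : Continuous (trigAlternant p) :=
  continuous_finsetSum _ fun _ _ => continuous_const.mul (ContinuousMap.continuous _)

/-- A permutation carrying one strictly decreasing tuple to another is increasing, hence trivial.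
Thus an alternant contains just one monomial with strictly decreasing exponents, and integrating
against that monomial isolates a signature. -/
lemma eq_one_of_comp_perm_eq {N : ℕ} {p q : Fin N → ℤ} (hp : StrictAnti p) (hq : StrictAnti q)
    {σ : Equiv.Perm (Fin N)} (h : p ∘ σ = q) : p = q ∧ σ = 1 := by
  have hσ : StrictMono σ := fun i j hij => by
    have h1 := hq hij
    rw [← h] at h1
    exact hp.lt_iff_gt.1 h1
  have h1 : (σ : Fin N → Fin N) = id :=
    (hσ.range_inj strictMono_id).1 (by simp)
  refine ⟨by rw [← h, h1, Function.comp_id], Equiv.ext fun i => congrFun h1 i⟩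

lemma integral_mFourier_mul_trigAlternant {N : ℕ} {p q : Fin N → ℤ} (hp : StrictAnti p)
    (hq : StrictAnti q) :
    ∫ t : UnitAddTorus (Fin N), UnitAddTorus.mFourier (-q) t * trigAlternant p t =
      if p = q then 1 else 0 := by
  have h1 : ∀ t, UnitAddTorus.mFourier (-q) t * trigAlternant p t =
      ∑ σ : Equiv.Perm (Fin N), ((Equiv.Perm.sign σ : ℤ) : ℂ) *
        UnitAddTorus.mFourier (-q + p ∘ σ) t := fun t => by
    rw [trigAlternant, Finset.mul_sum]
    refine Finset.sum_congr rfl fun σ _ => ?_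
    rw [UnitAddTorus.mFourier_add]
    ring
  simp_rw [h1]
  rw [integral_finsetSum]
  · simp_rw [integral_const_mul, integral_mFourier]
    have h2 : ∀ σ : Equiv.Perm (Fin N), -q + p ∘ σ = 0 ↔ p ∘ σ = q := fun σ => by
      rw [neg_add_eq_zero, eq_comm]
    simp_rw [h2]
    split_ifs with h
    · rw [Finset.sum_eq_single 1]
      · simp [h]
      · intro σ _ hσ
        rw [if_neg fun h' => hσ (eq_one_of_comp_perm_eq hp hq h').2, mul_zero]
      · simp
    · refine Finset.sum_eq_zero fun σ _ => ?_
      rw [if_neg fun h' => h (eq_one_of_comp_perm_eq hp hq h').1, mul_zero]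
  · intro σ _
    exact (continuous_const.mul (ContinuousMap.continuous _)).integrable_of_hasCompactSupport
      (HasCompactSupport.of_compactSpace _)

lemma HasMoments.continuous_evalAt_fourier {b : ℝ⟦X⟧} (hb : HasMoments b) :
    Continuous fun x : UnitAddCircle => evalAt (fourier 1 x) b := by
  refine continuous_tsum (fun n => ?_) hb.summable_abs fun n x => ?_
  · exact continuous_const.mul ((ContinuousMap.continuous _).pow n)
  · rw [norm_mul, norm_pow, norm_fourier_apply, one_pow, mul_one, Complex.norm_real,
      Real.norm_eq_abs]

lemma integral_mFourier_mul_det_evalAt {N : ℕ} {B : Fin N → ℝ⟦X⟧} (hB : ∀ j, HasMoments (B j))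
    (q : Fin N → ℤ) :
    ∫ t : UnitAddTorus (Fin N), UnitAddTorus.mFourier (-q) t *
      (Matrix.of fun i j : Fin N => evalAt (fourier 1 (t i)) (B j)).det =
      (((Matrix.of fun i j : Fin N => intCoeff (B j) (q i)).det : ℝ) : ℂ) := by
  have h1 : ∀ t : UnitAddTorus (Fin N), UnitAddTorus.mFourier (-q) t *
      (Matrix.of fun i j : Fin N => evalAt (fourier 1 (t i)) (B j)).det =
      ∑ σ : Equiv.Perm (Fin N), ((Equiv.Perm.sign σ : ℤ) : ℂ) *
        ∏ i, (fourier (-q i) (t i) : ℂ) * evalAt (fourier 1 (t i)) (B (σ i)) := fun t => by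
    rw [← Matrix.det_transpose, Matrix.det_apply', Finset.mul_sum]
    refine Finset.sum_congr rfl fun σ _ => ?_
    rw [Finset.prod_mul_distrib]
    simp only [UnitAddTorus.mFourier, ContinuousMap.coe_mk, Matrix.transpose_apply,
      Matrix.of_apply, Pi.neg_apply]
    ring
  simp_rw [h1]
  rw [integral_finsetSum]
  · simp_rw [integral_const_mul]
    rw [← Matrix.det_transpose, Matrix.det_apply']
    push_cast
    refine Finset.sum_congr rfl fun σ _ => ?_
    congr 1
    rw [integral_fintype_prod_volume_eq_prod
      (fun i x => (fourier (-q i) x : ℂ) * evalAt (fourier 1 x) (B (σ i)))]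
    refine Finset.prod_congr rfl fun i _ => ?_
    rw [integral_fourier_mul_evalAt (hB _)]
    rfl
  · intro σ _
    refine Continuous.integrable_of_hasCompactSupport ?_ (HasCompactSupport.of_compactSpace _)
    refine continuous_const.mul (continuous_finsetProd _ fun i _ => ?_)
    exact ((ContinuousMap.continuous _).mul (hB (σ i)).continuous_evalAt_fourier).comp
      (continuous_apply i)

/-- The Fourier coefficients of a Schur generating function of product form. -/
theorem div_schurFun_one_eq {N : ℕ} (hN : 0 < N) (ρ : PMF (Signature N)) {b : ℝ⟦X⟧}
    (hb : HasMoments b)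
    (h : ∀ u : Fin N → ℂ, (∀ i, ‖u i‖ = 1) → schurGenFun ρ u = ∏ i, evalAt (u i) b)
    (l : Signature N) :
    ((ρ l).toReal : ℂ) / schurFun l 1 = (vandermondeSign N : ℂ) *
      (((Matrix.of fun i j : Fin N =>
        intCoeff ((X - 1) ^ (j : ℕ) * b) (l.shifted i)).det : ℝ) : ℂ) := by
  have hsum : Summable fun l : Signature N => (ρ l).toReal :=
    ENNReal.summable_toReal ρ.tsum_coe_ne_top
  -- This is the generating function identity with the Vandermonde denominator cleared, which makes
  -- it valid on the whole torus: where two coordinates coincide, both sides are zero.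
  have key : ∀ t : UnitAddTorus (Fin N),
      ∑' l : Signature N, ((ρ l).toReal : ℂ) / schurFun l 1 * trigAlternant l.shifted t =
      (vandermondeSign N : ℂ) * (Matrix.of fun i j : Fin N =>
        evalAt (fourier 1 (t i)) ((X - 1) ^ (j : ℕ) * b)).det := by
    intro t
    set u : Fin N → ℂ := fun i => fourier 1 (t i) with hu
    have hu1 : ∀ i, ‖u i‖ = 1 := fun i => norm_fourier_apply 1 (t i)
    have hu0 : ∀ i, u i ≠ 0 := fun i => norm_ne_zero_iff.1 (by rw [hu1]; exact one_ne_zero)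
    -- The Vandermonde determinant is invariant under u ↦ u - 1. Powers of u - 1 are chosen because
    -- they become powers of x, and hence a triangular Gram matrix, after expansion at 1.
    have hdet : (Matrix.of fun i j : Fin N =>
        evalAt (fourier 1 (t i)) ((X - 1) ^ (j : ℕ) * b)).det =
        (∏ i, evalAt (u i) b) * (Matrix.vandermonde u).det := by
      rw [← Matrix.det_vandermonde_sub u 1, ← Matrix.det_mul_column]
      congr 1
      ext i j
      simp only [Matrix.of_apply, Matrix.vandermonde_apply]
      rw [evalAt_X_sub_one_pow_mul hb (hu1 i), mul_comm]
    rw [hdet]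
    by_cases hinj : Function.Injective u
    · have hV := Matrix.det_vandermonde_ne_zero_iff.2 hinj
      have he : (vandermondeSign N : ℂ) * vandermondeSign N = 1 := by
        exact_mod_cast vandermondeSign_mul_self N
      have he0 : (vandermondeSign N : ℂ) ≠ 0 := left_ne_zero_of_mul_eq_one he
      rw [← h u hu1, schurGenFun, mul_comm (∑' l, _), ← mul_assoc, ← tsum_mul_left]
      refine tsum_congr fun l => ?_
      rw [schurFun_of_injective hN l hinj hu0, alternantRatio, prod_sub_eq, trigAlternant_eq_det]
      field_simp
      rfl
    · rw [mul_comm (∏ i, _)]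
      have h0 : (Matrix.vandermonde u).det = 0 := by
        by_contra h0
        exact hinj (Matrix.det_vandermonde_ne_zero_iff.1 h0)
      rw [h0, zero_mul, mul_zero]
      refine (tsum_congr fun l => ?_).trans tsum_zero
      simp only [Function.Injective, not_forall] at hinj
      obtain ⟨i, j, hij, hne⟩ := hinj
      rw [trigAlternant_eq_det, Matrix.det_zero_of_row_eq hne, mul_zero]
      ext k
      exact congrArg (fun z => z ^ l.shifted k) hij
  have hint : ∫ t : UnitAddTorus (Fin N), UnitAddTorus.mFourier (-l.shifted) t *
      ∑' l : Signature N, ((ρ l).toReal : ℂ) / schurFun l 1 * trigAlternant l.shifted t =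
      ((ρ l).toReal : ℂ) / schurFun l 1 := by
    simp_rw [← tsum_mul_left]
    rw [← integral_tsum_of_summable_integral_norm]
    · have h2 : ∀ (k : Signature N) (t : UnitAddTorus (Fin N)),
          UnitAddTorus.mFourier (-l.shifted) t *
          (((ρ k).toReal : ℂ) / schurFun k 1 * trigAlternant k.shifted t) =
          ((ρ k).toReal : ℂ) / schurFun k 1 * (UnitAddTorus.mFourier (-l.shifted) t *
            trigAlternant k.shifted t) := fun k t => by ring
      simp_rw [h2, integral_const_mul]
      have h3 : ∀ k : Signature N, k.shifted = l.shifted ↔ k = l := fun k =>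
        ⟨fun h' => Subtype.ext (funext fun i => by
          have := congrFun h' i
          simp only [Signature.shifted] at this
          linarith), fun h' => by rw [h']⟩
      rw [tsum_eq_single l]
      · rw [integral_mFourier_mul_trigAlternant l.shifted_strictAnti l.shifted_strictAnti,
          if_pos rfl, mul_one]
      · intro k hk
        rw [integral_mFourier_mul_trigAlternant k.shifted_strictAnti l.shifted_strictAnti,
          if_neg (mt (h3 k).1 hk), mul_zero]
    · intro k
      refine Continuous.integrable_of_hasCompactSupport ?_ (HasCompactSupport.of_compactSpace _)
      exact (ContinuousMap.continuous _).mul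
        (continuous_const.mul (continuous_trigAlternant _))
    · refine Summable.of_nonneg_of_le (fun k => integral_nonneg fun _ => norm_nonneg _)
        (fun k => ?_) (hsum.mul_right (Fintype.card (Equiv.Perm (Fin N)) : ℝ))
      have hbound : ∀ t : UnitAddTorus (Fin N), ‖UnitAddTorus.mFourier (-l.shifted) t *
          (((ρ k).toReal : ℂ) / schurFun k 1 * trigAlternant k.shifted t)‖ ≤
          (ρ k).toReal * (Fintype.card (Equiv.Perm (Fin N)) : ℝ) := fun t => by
        have hm : ‖UnitAddTorus.mFourier (-l.shifted) t‖ = 1 := by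
          simp only [UnitAddTorus.mFourier, ContinuousMap.coe_mk, norm_prod, norm_fourier_apply,
            Finset.prod_const_one]
        rw [norm_mul, hm, one_mul, norm_mul, norm_div, Complex.norm_real,
          Real.norm_of_nonneg ENNReal.toReal_nonneg]
        refine mul_le_mul ?_ (norm_trigAlternant_le _ _) (norm_nonneg _) ENNReal.toReal_nonneg
        exact div_le_self ENNReal.toReal_nonneg (one_le_norm_schurFun_one hN k)
      refine (integral_mono_of_nonneg (Eventually.of_forall fun _ => norm_nonneg _)
        (integrable_const _) (Eventually.of_forall hbound)).trans (le_of_eq ?_)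
      rw [integral_const, show (volume : Measure (UnitAddTorus (Fin N))).real Set.univ = 1 from
        probReal_univ (μ := Measure.pi fun _ => volume), one_smul]
  rw [← hint]
  simp_rw [key]
  rw [← integral_mFourier_mul_det_evalAt fun j => hb.X_sub_one_pow_mul (j : ℕ),
    ← integral_const_mul]
  refine integral_congr_ae (Eventually.of_forall fun t => ?_)
  ring

/-- The probability of a signature with nonnegative shifted coordinates. -/
theorem toReal_eq_det_mul_det {N : ℕ} (hN : 0 < N) (ρ : PMF (Signature N)) {b : ℝ⟦X⟧}
    (hb : HasMoments b)
    (h : ∀ u : Fin N → ℂ, (∀ i, ‖u i‖ = 1) → schurGenFun ρ u = ∏ i, evalAt (u i) b)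
    (l : Signature N) (n : Fin N → ℕ) (hn : ∀ i, (n i : ℤ) = l.shifted i) :
    (ρ l).toReal = (Matrix.of fun i j : Fin N => ((n i).choose j : ℝ)).det *
      (Matrix.of fun i j : Fin N => coeff (n i) ((X - 1) ^ (j : ℕ) * b)).det := by
  have h1 := div_schurFun_one_eq hN ρ hb h l
  have h0 : schurFun l 1 ≠ 0 := by
    rw [← norm_pos_iff]
    exact zero_lt_one.trans_le (one_le_norm_schurFun_one hN l)
  have h2 : ∀ i (c : ℝ⟦X⟧), intCoeff c (l.shifted i) = coeff (n i) c := fun i c => by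
    rw [← hn, intCoeff, if_pos (by positivity), Int.toNat_natCast]
  simp_rw [h2] at h1
  rw [div_eq_iff h0, schurFun_one hN l (c := 0) (n := n) (by simpa using hn)] at h1
  have h3 : (((Matrix.of fun i j : Fin N => ((n i).choose j : ℤ)).det : ℤ) : ℝ) =
      (Matrix.of fun i j : Fin N => ((n i).choose j : ℝ)).det := by
    rw [Int.cast_det]
    congr 1
  have he : (vandermondeSign N : ℝ) * vandermondeSign N = 1 := by
    exact_mod_cast vandermondeSign_mul_self N
  rw [← h3]
  have h4 : (ρ l).toReal = vandermondeSign N *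
      (Matrix.of fun i j : Fin N => coeff (n i) ((X - 1) ^ (j : ℕ) * b)).det *
      ((vandermondeSign N * (Matrix.of fun i j : Fin N => ((n i).choose j : ℤ)).det : ℤ) : ℝ) := by
    rw [← Complex.ofReal_inj, h1, Complex.ofReal_mul, Complex.ofReal_mul, Complex.ofReal_intCast,
      Complex.ofReal_intCast]
  rw [h4, Int.cast_mul]
  linear_combination ((Matrix.of fun i j : Fin N => ((n i).choose j : ℤ)).det : ℝ) *
    (Matrix.of fun i j : Fin N => coeff (n i) ((X - 1) ^ (j : ℕ) * b)).det * he

/-- The series in u have no negative powers, so a negative coordinate gives a zero row in the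
determinant. -/
theorem eq_zero_of_shifted_neg {N : ℕ} (hN : 0 < N) (ρ : PMF (Signature N)) {b : ℝ⟦X⟧}
    (hb : HasMoments b)
    (h : ∀ u : Fin N → ℂ, (∀ i, ‖u i‖ = 1) → schurGenFun ρ u = ∏ i, evalAt (u i) b)
    (l : Signature N) (i : Fin N) (hi : l.shifted i < 0) : (ρ l).toReal = 0 := by
  have h1 := div_schurFun_one_eq hN ρ hb h l
  have h0 : schurFun l 1 ≠ 0 := by
    rw [← norm_pos_iff]
    exact zero_lt_one.trans_le (one_le_norm_schurFun_one hN l)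
  rw [div_eq_iff h0, Matrix.det_eq_zero_of_row_eq_zero i fun j => ?_] at h1
  · simpa using h1
  · rw [Matrix.of_apply, intCoeff, if_neg (not_le.2 hi)]

end DiscreteBBP

/-! ### The Andréief identity over strictly decreasing tuples -/

namespace DiscreteBBP

lemma hasSum_mul_of_real {β γ : Type*} {f : β → ℝ} {g : γ → ℝ} {a b : ℝ} (hf : HasSum f a)
    (hg : HasSum g b) : HasSum (fun x : β × γ => f x.1 * g x.2) (a * b) :=
  hf.mul hg (summable_mul_of_summable_norm hf.summable.norm hg.summable.norm)

lemma hasSum_prod_pi {N : ℕ} (f : Fin N → ℕ → ℝ) (hf : ∀ i, Summable (f i)) :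
    HasSum (fun n : Fin N → ℕ => ∏ i, f i (n i)) (∏ i, ∑' n, f i n) := by
  induction N with
  | zero =>
    simp only [Finset.univ_eq_empty, Finset.prod_empty]
    exact hasSum_unique (fun _ : Fin 0 → ℕ => (1 : ℝ))
  | succ N ih =>
    have h := ih (fun i => f i.succ) fun i => hf i.succ
    rw [← (Fin.consEquiv fun _ : Fin (N + 1) => ℕ).hasSum_iff]
    have h2 := hasSum_mul_of_real (hf 0).hasSum h
    rw [Fin.prod_univ_succ]
    convert h2 using 2 with x
    simp [Fin.prod_univ_succ, Fin.consEquiv]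

/-- Strictly decreasing tuples and permutations parametrize the injective tuples. -/
lemma injective_strictAnti_comp_perm (N : ℕ) : Function.Injective
    fun x : {n : Fin N → ℕ // StrictAnti n} × Equiv.Perm (Fin N) => x.1.1 ∘ x.2 := by
  rintro ⟨⟨p, hp⟩, σ⟩ ⟨⟨q, hq⟩, τ⟩ h
  have h1 : p ∘ (σ * τ⁻¹ : Equiv.Perm (Fin N)) = q := by
    ext i
    have := congrFun h (τ⁻¹ i)
    simpa using this
  have hσ : StrictMono (σ * τ⁻¹ : Equiv.Perm (Fin N)) := fun i j hij => by
    have h2 := hq hij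
    rw [← h1] at h2
    exact hp.lt_iff_gt.1 h2
  have h3 : ((σ * τ⁻¹ : Equiv.Perm (Fin N)) : Fin N → Fin N) = id :=
    (hσ.range_inj strictMono_id).1 (by simp)
  have h4 : σ * τ⁻¹ = 1 := Equiv.ext fun i => congrFun h3 i
  have h5 : σ = τ := mul_inv_eq_one.1 h4
  have h6 : p = q := by rw [← h1, h3, Function.comp_id]
  subst h5 h6
  rfl

lemma mem_range_strictAnti_comp_perm {N : ℕ} {n : Fin N → ℕ} (hn : Function.Injective n) :
    n ∈ Set.range
      fun x : {n : Fin N → ℕ // StrictAnti n} × Equiv.Perm (Fin N) => x.1.1 ∘ x.2 := by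
  set τ := Tuple.sort (OrderDual.toDual ∘ n)
  have h1 : Antitone (n ∘ τ) := Tuple.monotone_sort (OrderDual.toDual ∘ n)
  have h2 : StrictAnti (n ∘ τ) := h1.strictAnti_of_injective (hn.comp τ.injective)
  refine ⟨(⟨n ∘ τ, h2⟩, τ⁻¹), ?_⟩
  ext i
  simp

/-- The Andréief (Cauchy–Binet) identity for determinants of sums over `ℕ`. -/
theorem hasSum_det_mul_det {N : ℕ} (φ ψ : Fin N → ℕ → ℝ)
    (h : ∀ i j, Summable fun n => φ i n * ψ j n) :
    HasSum (fun n : {n : Fin N → ℕ // StrictAnti n} =>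
      (Matrix.of fun i j => φ j (n.1 i)).det * (Matrix.of fun i j => ψ j (n.1 i)).det)
      (Matrix.of fun i j => ∑' n, φ i n * ψ j n).det := by
  -- Only one determinant is expanded, so the sum over all tuples factorizes. Tuples with a
  -- repetition contribute zero, and the orbits of the others under permutation rebuild the second
  -- determinant.
  have h1 : HasSum (fun n : Fin N → ℕ => (∏ i, ψ i (n i)) * (Matrix.of fun i j => φ j (n i)).det)
      (Matrix.of fun i j => ∑' n, φ i n * ψ j n).det := by
    rw [Matrix.det_apply']
    have h2 : ∀ n : Fin N → ℕ, (∏ i, ψ i (n i)) * (Matrix.of fun i j => φ j (n i)).det =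
        ∑ σ : Equiv.Perm (Fin N), ((Equiv.Perm.sign σ : ℤ) : ℝ) *
          ∏ i, φ (σ i) (n i) * ψ i (n i) := fun n => by
      rw [← Matrix.det_transpose, Matrix.det_apply', Finset.mul_sum]
      refine Finset.sum_congr rfl fun σ _ => ?_
      rw [Finset.prod_mul_distrib]
      simp only [Matrix.transpose_apply, Matrix.of_apply]
      ring
    simp_rw [h2]
    refine hasSum_sum fun σ _ => HasSum.mul_left _ ?_
    exact hasSum_prod_pi (fun i n => φ (σ i) n * ψ i n) fun i => h _ _
  rw [← (injective_strictAnti_comp_perm N).hasSum_iff] at h1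
  · convert h1.prod_fiberwise fun n => hasSum_fintype _ using 2 with n
    have h3 : ∀ σ : Equiv.Perm (Fin N), (Matrix.of fun i j => φ j (n.1 (σ i))).det =
        ((Equiv.Perm.sign σ : ℤ) : ℝ) * (Matrix.of fun i j => φ j (n.1 i)).det := fun σ =>
      Matrix.det_permute σ (Matrix.of fun i j => φ j (n.1 i))
    simp only [Function.comp_apply, h3]
    rw [← Matrix.det_transpose (Matrix.of fun i j => ψ j (n.1 i)), mul_comm,
      ← Equiv.sum_comp (Equiv.inv (Equiv.Perm (Fin N)))]
    rw [Matrix.det_apply', Finset.sum_mul]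
    refine Finset.sum_congr rfl fun σ _ => ?_
    simp only [Equiv.inv_apply, Equiv.Perm.sign_inv, Matrix.transpose_apply, Matrix.of_apply]
    rw [← Equiv.prod_comp σ fun i => ψ i (n.1 (σ⁻¹ i))]
    simp only [Equiv.Perm.coe_inv, Equiv.symm_apply_apply]
    ring
  · intro n hn
    have h4 : ¬ Function.Injective n := fun h4 => hn (mem_range_strictAnti_comp_perm h4)
    simp only [Function.Injective, not_forall] at h4
    obtain ⟨i, j, hij, hne⟩ := h4
    rw [Matrix.det_zero_of_row_eq hne, mul_zero]
    ext k
    simp [hij]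

/-- In each Leibniz term every row index is used once, so putting the weight on one factor at a time
collects the full sum of weights. A linear statistic times a determinant thus becomes a sum of
determinants with one altered column, to which Andréief applies. -/
lemma sum_mul_det_eq {N : ℕ} (w : Fin N → ℝ) (M : Matrix (Fin N) (Fin N) ℝ) :
    (∑ i, w i) * M.det = ∑ r, (M.updateCol r fun i => w i * M i r).det := by
  simp_rw [Matrix.det_apply']
  rw [Finset.sum_comm, Finset.mul_sum]
  refine Finset.sum_congr rfl fun σ _ => ?_
  rw [← Equiv.sum_comp σ w, Finset.sum_mul]
  refine Finset.sum_congr rfl fun r _ => ?_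
  rw [← Finset.mul_prod_erase _ _ (Finset.mem_univ r),
    ← Finset.mul_prod_erase _ _ (Finset.mem_univ r), Matrix.updateCol_self,
    Finset.prod_congr rfl fun i hi => Matrix.updateCol_ne (Finset.ne_of_mem_erase hi)]
  ring

end DiscreteBBP

/-! ### Exact falling factorial moments -/

namespace DiscreteBBP
open PowerSeries

lemma iterate_derivative_mul (a b : ℝ⟦X⟧) (k : ℕ) :
    (d⁄dX ℝ)^[k] (a * b) = ∑ p ∈ Finset.HasAntidiagonal.antidiagonal k,
      k.choose p.1 • ((d⁄dX ℝ)^[p.1] a * (d⁄dX ℝ)^[p.2] b) := by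
  induction k with
  | zero => simp
  | succ k ih =>
    rw [Finset.sum_antidiagonal_choose_succ_nsmul
      (fun i j => (d⁄dX ℝ)^[i] a * (d⁄dX ℝ)^[j] b), Function.iterate_succ_apply', ih, map_sum,
      ← Finset.sum_add_distrib]
    refine Finset.sum_congr rfl fun p hp => ?_
    rw [map_nsmul, Derivation.leibniz, Function.iterate_succ_apply', Function.iterate_succ_apply',
      smul_eq_mul, smul_eq_mul, smul_add, mul_comm ((d⁄dX ℝ)^[p.2] b),
      ← Nat.choose_symm_of_eq_add (Finset.HasAntidiagonal.mem_antidiagonal.1 hp).symm]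

lemma iterate_derivative_expSeries (c : ℝ) (m : ℕ) :
    (d⁄dX ℝ)^[m] (expSeries c) = C (c ^ m) * expSeries c := by
  have h : d⁄dX ℝ (expSeries c) = C c * expSeries c := by
    ext n
    rw [coeff_derivative, coeff_C_mul, expSeries, coeff_mk, coeff_mk, Nat.factorial_succ]
    push_cast
    field_simp
    ring
  induction m with
  | zero => simp
  | succ m ih =>
    rw [Function.iterate_succ_apply', ih, Derivation.leibniz, h, derivative_C, smul_zero, add_zero,
      smul_eq_mul, pow_succ, map_mul, mul_assoc]

lemma derivative_powSeries (α : ℝ) : d⁄dX ℝ (powSeries α) = C α * powSeries α ^ 2 := by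
  ext n
  rw [coeff_derivative, coeff_C_mul, pow_two, coeff_mul, powSeries, coeff_mk,
    Finset.sum_congr rfl (g := fun _ => α ^ n) fun p hp => by
      rw [coeff_mk, coeff_mk, ← pow_add, Finset.HasAntidiagonal.mem_antidiagonal.1 hp],
    Finset.sum_const, Finset.Nat.card_antidiagonal, nsmul_eq_mul]
  push_cast
  ring

lemma iterate_derivative_powSeries (α : ℝ) (l : ℕ) :
    (d⁄dX ℝ)^[l] (powSeries α) = C (l.factorial * α ^ l) * powSeries α ^ (l + 1) := by
  induction l with
  | zero => simp
  | succ l ih =>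
    rw [Function.iterate_succ_apply', ih, Derivation.leibniz, derivative_C, smul_zero, add_zero,
      smul_eq_mul, derivative_pow, derivative_powSeries, Nat.factorial_succ]
    push_cast
    simp only [map_mul, map_pow, map_add, map_one, map_natCast]
    ring

lemma iterate_derivative_X_pow (r i : ℕ) :
    (d⁄dX ℝ)^[i] (X ^ r : ℝ⟦X⟧) = C (r.descFactorial i : ℝ) * X ^ (r - i) := by
  induction i with
  | zero => simp
  | succ i ih =>
    rw [Function.iterate_succ_apply', ih, Derivation.leibniz, derivative_C, smul_zero, add_zero,
      smul_eq_mul, derivative_pow, derivative_X, Nat.descFactorial_succ, Nat.sub_sub]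
    push_cast
    rw [map_mul, map_natCast, map_natCast]
    ring

/-- The quotient of `(1 + x) ^ k ∂ ^ k (x ^ r f)` by `f = exp (c x) / (1 - α x)`. -/
noncomputable def conjugatedDerivative (c α : ℝ) (k r : ℕ) : ℝ⟦X⟧ :=
  ∑ p ∈ Finset.HasAntidiagonal.antidiagonal k, ∑ q ∈ Finset.HasAntidiagonal.antidiagonal p.2,
    C ((k.choose p.1 : ℝ) * r.descFactorial p.1 * (p.2.choose q.1 * (q.1.factorial * α ^ q.1 *
      c ^ q.2))) * (X ^ (r - p.1) * ((1 + X) ^ k * powSeries α ^ q.1))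

/-- Leibniz twice: every derivative of either factor of f is that factor times an explicit series,
so f can be pulled out. -/
lemma mul_iterate_derivative_eq (c α : ℝ) (k r : ℕ) :
    (1 + X) ^ k * (d⁄dX ℝ)^[k] (X ^ r * (expSeries c * powSeries α)) =
      expSeries c * powSeries α * conjugatedDerivative c α k r := by
  rw [iterate_derivative_mul, conjugatedDerivative, Finset.mul_sum, Finset.mul_sum]
  refine Finset.sum_congr rfl fun p _ => ?_
  rw [mul_comm (expSeries c), iterate_derivative_mul, iterate_derivative_X_pow]
  simp only [Finset.mul_sum, Finset.smul_sum]
  refine Finset.sum_congr rfl fun q _ => ?_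
  rw [iterate_derivative_expSeries, iterate_derivative_powSeries]
  simp only [map_mul, map_natCast, nsmul_eq_mul]
  ring

/-- The monomial X^(r-p) shifts the index back to p, leaving r only in the falling factorial, so the
sum over r can be done in closed form. When p > r the truncated subtraction is harmless because that
factorial vanishes. -/
lemma coeff_conjugatedDerivative (c α : ℝ) (k r : ℕ) :
    coeff r (conjugatedDerivative c α k r) =
      ∑ p ∈ Finset.HasAntidiagonal.antidiagonal k, ∑ q ∈ Finset.HasAntidiagonal.antidiagonal p.2,
        (k.choose p.1 : ℝ) * r.descFactorial p.1 * (p.2.choose q.1 * (q.1.factorial * α ^ q.1 *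
          c ^ q.2)) * coeff p.1 ((1 + X) ^ k * powSeries α ^ q.1) := by
  simp only [conjugatedDerivative, map_sum]
  refine Finset.sum_congr rfl fun p _ => Finset.sum_congr rfl fun q _ => ?_
  rw [coeff_C_mul, coeff_X_pow_mul', if_pos (Nat.sub_le _ _)]
  rcases le_or_gt p.1 r with h | h
  · rw [Nat.sub_sub_self h]
  · rw [Nat.descFactorial_of_lt h]
    simp

lemma sum_range_descFactorial (N i : ℕ) :
    ∑ r ∈ Finset.range N, (r.descFactorial i : ℝ) = N.descFactorial (i + 1) / (i + 1) := by
  rw [eq_div_iff (by positivity)]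
  induction N with
  | zero => simp
  | succ N ih =>
    rw [Finset.sum_range_succ, add_mul, ih, Nat.succ_descFactorial_succ, Nat.descFactorial_succ]
    rcases le_or_gt i N with h | h
    · push_cast [h]; ring
    · rw [Nat.descFactorial_of_lt h]; simp

lemma add_le_add_of_strictAnti {N : ℕ} {n : Fin N → ℕ} (hn : StrictAnti n) {i j : Fin N}
    (hij : i ≤ j) : n j + j ≤ n i + i := by
  obtain ⟨d, hd⟩ := Nat.exists_eq_add_of_le (show (i : ℕ) ≤ j from hij)
  induction d generalizing j with
  | zero => rw [Fin.ext (show (j : ℕ) = i by omega)]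
  | succ d ih =>
    have h1 : (i : ℕ) + d < N := by omega
    have h2 := ih (j := ⟨i + d, h1⟩) (Fin.le_def.2 (by simp)) rfl
    have h3 := hn (show (⟨i + d, h1⟩ : Fin N) < j from Fin.lt_def.2 (by simp; omega))
    simp only at h2
    omega

/-- The signature with given nonnegative shifted coordinates. -/
def signatureOfStrictAnti {N : ℕ} (n : {n : Fin N → ℕ // StrictAnti n}) : Signature N :=
  ⟨fun i => n.1 i - N + 1 + i, fun i j hij => by
    have := add_le_add_of_strictAnti n.2 hij
    simp only
    omega⟩

lemma shifted_signatureOfStrictAnti {N : ℕ} (n : {n : Fin N → ℕ // StrictAnti n}) (i : Fin N) :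
    (signatureOfStrictAnti n).shifted i = n.1 i := by
  simp only [Signature.shifted, signatureOfStrictAnti]
  ring

lemma hasSum_signature {N : ℕ} {f : Signature N → ℝ} {s : ℝ}
    (hf : ∀ l, (∃ i, l.shifted i < 0) → f l = 0)
    (h : HasSum (fun n => f (signatureOfStrictAnti n)) s) : HasSum f s := by
  have hinj : Function.Injective (signatureOfStrictAnti (N := N)) := fun n m hnm =>
    Subtype.ext (funext fun i => by
      have h1 := shifted_signatureOfStrictAnti n i
      rw [hnm, shifted_signatureOfStrictAnti] at h1
      exact_mod_cast h1.symm)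
  refine (hinj.hasSum_iff fun l hl => hf l ?_).1 h
  by_contra! hneg
  refine hl ⟨⟨fun i => (l.shifted i).toNat, fun i j hij => ?_⟩, Subtype.ext (funext fun i => ?_)⟩
  · have h1 := l.shifted_strictAnti hij
    have h2 := hneg i
    have h3 := hneg j
    simp only
    omega
  · have h2 := hneg i
    simp only [signatureOfStrictAnti]
    rw [Int.toNat_of_nonneg h2, Signature.shifted]
    ring

/-- The expected power sums of the shifted coordinates, weighted by falling factorials. -/
theorem hasSum_falling {N : ℕ} (hN : 0 < N) (ρ : PMF (Signature N)) {c α : ℝ} (hc : 0 ≤ c)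
    (hα : 0 ≤ α) (h : ∀ u : Fin N → ℂ, (∀ i, ‖u i‖ = 1) → schurGenFun ρ u =
      ∏ i, Complex.exp (c * (u i - 1)) * (1 / (1 - α * (u i - 1)))) (k : ℕ) :
    HasSum (fun l : Signature N => (ρ l).toReal *
      ∑ i, (descPochhammer ℝ k).eval (l.shifted i : ℝ))
      (∑ p ∈ Finset.HasAntidiagonal.antidiagonal k, ∑ q ∈ Finset.HasAntidiagonal.antidiagonal p.2,
        (k.choose p.1 : ℝ) * (N.descFactorial (p.1 + 1) / (p.1 + 1)) * (p.2.choose q.1 *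
          (q.1.factorial * α ^ q.1 * c ^ q.2)) * coeff p.1 ((1 + X) ^ k * powSeries α ^ q.1)) := by
  set b := symbolSeries c α with hb'
  have hb : HasMoments b := hasMoments_symbolSeries hc hα
  have hf : recenter b = expSeries c * powSeries α := recenter_symbolSeries hc hα
  have h' : ∀ u : Fin N → ℂ, (∀ i, ‖u i‖ = 1) → schurGenFun ρ u = ∏ i, evalAt (u i) b :=
    fun u hu => by
      rw [h u hu]
      exact Finset.prod_congr rfl fun i _ => (evalAt_symbolSeries hc hα (hu i)).symm
  refine hasSum_signature (fun l ⟨i, hi⟩ => by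
    rw [eq_zero_of_shifted_neg hN ρ hb h' l i hi, zero_mul]) ?_
  set φ : Fin N → ℕ → ℝ := fun i n => (n.choose i : ℝ)
  set B : Fin N → ℝ⟦X⟧ := fun j => (X - 1) ^ (j : ℕ) * b
  have hB : ∀ j, HasMoments (B j) := fun j => hb.X_sub_one_pow_mul _
  -- The second family of functions, with the falling factorial weight placed on column r only.
  set ψ : Fin N → Fin N → ℕ → ℝ := fun r j n =>
    if j = r then (n.descFactorial k : ℝ) * coeff n (B j) else coeff n (B j) with hψ
  set G : Matrix (Fin N) (Fin N) ℝ := Matrix.of fun i j => coeff i (X ^ (j : ℕ) * recenter b)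
    with hG
  have hsum : ∀ r i j, Summable fun n => φ i n * ψ r j n := fun r i j => by
    by_cases hjr : j = r
    · simp only [hψ, if_pos hjr, φ]
      simp_rw [← coeff_X_pow_mul_iterate_derivative]
      exact (((hB j).iterate_derivative k).X_pow_mul k).summable_choose i |>.of_norm
    · simp only [hψ, if_neg hjr, φ]
      exact ((hB j).summable_choose i).of_norm
  -- The altered column holds the coefficients of f times `conjugatedDerivative`. Since G is lower
  -- triangular with columns x^j f, this is G applied to the coefficient vector, and truncating that
  -- vector at N loses nothing for i < N.
  have hpair : ∀ r, (Matrix.of fun i j => ∑' n, φ i n * ψ r j n) = G.updateCol r (G.mulVec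
      fun a => coeff a (conjugatedDerivative c α k r)) := fun r => by
    ext i j
    rw [Matrix.of_apply, Matrix.updateCol_apply]
    split_ifs with hjr
    · subst hjr
      simp only [hψ, if_pos rfl, φ]
      rw [tsum_choose_mul_descFactorial (hB j), recenter_X_sub_one_pow_mul hb, hf,
        mul_iterate_derivative_eq, mul_comm, coeff_mul,
        Finset.Nat.sum_antidiagonal_eq_sum_range_succ_mk, Matrix.mulVec, dotProduct, hG, hf]
      simp only [Matrix.of_apply, coeff_X_pow_mul']
      rw [← Finset.sum_range (fun a => (if a ≤ (i : ℕ) then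
        coeff ((i : ℕ) - a) (expSeries c * powSeries α) else 0) *
        coeff a (conjugatedDerivative c α k j))]
      refine Finset.sum_subset_zero_on_sdiff (Finset.range_mono (by omega)) (fun a ha => ?_)
        fun a ha => ?_
      · rw [Finset.mem_sdiff, Finset.mem_range, Finset.mem_range] at ha
        rw [if_neg (by omega), zero_mul]
      · rw [Finset.mem_range] at ha
        rw [if_pos (by omega), mul_comm]
    · simp only [hψ, if_neg hjr, φ]
      rw [← coeff_recenter, recenter_X_sub_one_pow_mul hb, hG, Matrix.of_apply]
  have hdetG : G.det = 1 := by
    rw [Matrix.det_of_isLowerTriangular]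
    · refine Finset.prod_eq_one fun i _ => ?_
      rw [hG, Matrix.of_apply, coeff_X_pow_mul', if_pos le_rfl, Nat.sub_self, hf, coeff_mul]
      simp [expSeries, powSeries]
    · intro i j hij
      rw [hG, Matrix.of_apply, coeff_X_pow_mul', if_neg]
      exact not_le.2 hij
  -- Cramer's rule with det G = 1: replacing column r of G by G v gives determinant v r.
  have hdet : ∀ r, (Matrix.of fun i j => ∑' n, φ i n * ψ r j n).det =
      coeff r (conjugatedDerivative c α k r) := fun r => by
    rw [hpair, ← Matrix.cramer_apply, Matrix.cramer_eq_adjugate_mulVec, Matrix.mulVec_mulVec,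
      Matrix.adjugate_mul, hdetG, one_smul, Matrix.one_mulVec]
  have h1 := hasSum_sum (s := Finset.univ) fun r (_ : r ∈ Finset.univ) =>
    hasSum_det_mul_det φ (ψ r) (hsum r)
  simp only [hdet, coeff_conjugatedDerivative] at h1
  convert h1 using 1
  · ext n
    rw [toReal_eq_det_mul_det hN ρ hb h' (signatureOfStrictAnti n) n.1
      fun i => (shifted_signatureOfStrictAnti n i).symm, ← Finset.mul_sum, mul_assoc]
    congr 1
    rw [mul_comm]
    simp_rw [shifted_signatureOfStrictAnti, Int.cast_natCast,
      descPochhammer_eval_eq_descFactorial]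
    rw [sum_mul_det_eq]
    refine Finset.sum_congr rfl fun r _ => ?_
    congr 1
    ext i j
    simp only [Matrix.updateCol_apply, Matrix.of_apply, hψ]
    split_ifs with hjr
    · rw [hjr]
    · rfl
  · rw [Finset.sum_comm]
    refine Finset.sum_congr rfl fun p _ => ?_
    rw [Finset.sum_comm]
    refine Finset.sum_congr rfl fun q _ => ?_
    rw [← sum_range_descFactorial, Finset.sum_range]
    simp only [Finset.mul_sum, Finset.sum_mul]

end DiscreteBBP

/-! ### Expansion of the moments to order 1/N -/

namespace DiscreteBBP
open PowerSeries

/-- The expansion `x N = a + b / N + o(1 / N)`. -/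
def HasExpansion (x : ℕ → ℝ) (a b : ℝ) : Prop :=
  Tendsto (fun N : ℕ => (N : ℝ) * (x N - a)) atTop (𝓝 b)

namespace HasExpansion

lemma congr' {x y : ℕ → ℝ} {a b : ℝ} (hx : HasExpansion x a b) (h : ∀ N, 1 ≤ N → x N = y N) :
    HasExpansion y a b :=
  Tendsto.congr' (by filter_upwards [eventually_ge_atTop 1] with N hN; rw [h N hN]) hx

lemma const (a : ℝ) : HasExpansion (fun _ => a) a 0 := by
  simp [HasExpansion]

lemma add {x y : ℕ → ℝ} {a b c d : ℝ} (hx : HasExpansion x a b) (hy : HasExpansion y c d) :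
    HasExpansion (fun N => x N + y N) (a + c) (b + d) :=
  (Tendsto.add hx hy).congr fun N => by ring

lemma const_mul {x : ℕ → ℝ} {a b : ℝ} (c : ℝ) (hx : HasExpansion x a b) :
    HasExpansion (fun N => c * x N) (c * a) (c * b) :=
  (Tendsto.const_mul c hx).congr fun N => by ring

lemma sum {ι : Type*} (s : Finset ι) {x : ι → ℕ → ℝ} {a b : ι → ℝ}
    (h : ∀ i ∈ s, HasExpansion (x i) (a i) (b i)) :
    HasExpansion (fun N => ∑ i ∈ s, x i N) (∑ i ∈ s, a i) (∑ i ∈ s, b i) := by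
  refine (tendsto_finsetSum s h).congr fun N => ?_
  rw [← Finset.mul_sum, Finset.sum_sub_distrib]

lemma tendsto {x : ℕ → ℝ} {a b : ℝ} (hx : HasExpansion x a b) : Tendsto x atTop (𝓝 a) := by
  have h := (tendsto_one_div_atTop_nhds_zero_nat (𝕜 := ℝ)).mul hx
  have h2 := h.add_const a
  rw [zero_mul, zero_add] at h2
  refine h2.congr' ?_
  filter_upwards [eventually_ge_atTop 1] with N hN
  have : (N : ℝ) ≠ 0 := by positivity
  field_simp
  ring

lemma mul {x y : ℕ → ℝ} {a b c d : ℝ} (hx : HasExpansion x a b) (hy : HasExpansion y c d) :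
    HasExpansion (fun N => x N * y N) (a * c) (b * c + a * d) :=
  ((Tendsto.mul hx hy.tendsto).add (Tendsto.const_mul a hy)).congr fun N => by ring

lemma inv : HasExpansion (fun N => (N : ℝ)⁻¹) 0 1 := by
  refine tendsto_const_nhds.congr' ?_
  filter_upwards [eventually_ge_atTop 1] with N hN
  have : (N : ℝ) ≠ 0 := by positivity
  field_simp
  simp

lemma inv_pow (l : ℕ) : HasExpansion (fun N => (N : ℝ)⁻¹ ^ l) (if l = 0 then 1 else 0)
    (if l = 1 then 1 else 0) := by
  induction l with
  | zero => simpa using const 1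
  | succ l ih =>
    simp_rw [pow_succ]
    convert ih.mul inv using 1
    · simp
    · rcases l with _ | l <;> simp

/-- The product of the factors 1 - j/N over j < i, to first order. -/
lemma descFactorial (i : ℕ) : HasExpansion (fun N => (N.descFactorial i : ℝ) * (N : ℝ)⁻¹ ^ i) 1
    (-(i * (i - 1) / 2)) := by
  induction i with
  | zero => simpa using const 1
  | succ i ih =>
    have h := ih.mul ((const 1).add (inv.const_mul (-i : ℝ)))
    rw [show (1 : ℝ) * (1 + -i * 0) = 1 by ring,
      show -((i : ℝ) * (i - 1) / 2) * (1 + -i * 0) + 1 * (0 + -i * 1) =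
        -(((i + 1 : ℕ) : ℝ) * (((i + 1 : ℕ) : ℝ) - 1) / 2) by push_cast; ring] at h
    refine h.congr' fun N hN => ?_
    have hN0 : (N : ℝ) ≠ 0 := by positivity
    rw [Nat.descFactorial_succ, pow_succ]
    rcases le_or_gt i N with h1 | h1
    · push_cast [h1]
      field_simp
      ring
    · rw [Nat.descFactorial_of_lt h1]
      simp

end HasExpansion

/-- The `k`-th moment of the limit measure. -/
noncomputable def limitMoment (γ : ℝ) (k : ℕ) : ℝ :=
  ∑ i ∈ Finset.range (k + 1), (k.choose i : ℝ) ^ 2 * γ ^ (k - i) / (i + 1)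

/-- The contribution of the spike to the `k`-th moment of the correction. -/
noncomputable def spikeMoment (γ α : ℝ) (k : ℕ) : ℝ :=
  ∑ i ∈ Finset.range (k + 1), ∑ j ∈ Finset.range i,
    (k.choose i : ℝ) * k.choose j * γ ^ (k - i) * α ^ (i - j)

lemma coeff_one_add_X_pow (k i : ℕ) : coeff i ((1 + X : ℝ⟦X⟧) ^ k) = k.choose i := by
  rw [← Polynomial.coe_X, ← Polynomial.coe_one, ← Polynomial.coe_add, ← Polynomial.coe_pow,
    Polynomial.coeff_coe, Polynomial.coeff_one_add_X_pow]

/-- From i C(k, i) = k C(k-1, i-1). This evaluates the 1/N correction coming from the falling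
factorials of N. -/
lemma sum_sq_choose_mul (γ : ℝ) (k : ℕ) :
    ∑ i ∈ Finset.range (k + 1), (k.choose i : ℝ) ^ 2 * γ ^ (k - i) * i =
      (k : ℝ) ^ 2 * limitMoment γ (k - 1) := by
  rw [Finset.sum_range_succ']
  simp only [Nat.cast_zero, mul_zero, add_zero]
  rcases k with _ | k
  · simp
  rw [limitMoment, Finset.mul_sum, Nat.add_sub_cancel]
  refine Finset.sum_congr rfl fun i _ => ?_
  have h := congrArg (Nat.cast (R := ℝ)) (Nat.add_one_mul_choose_eq k i)
  rw [Nat.add_sub_add_right]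
  push_cast at h ⊢
  field_simp
  linear_combination (-(γ ^ (k - i)) * (((k + 1).choose (i + 1) : ℝ) * (i + 1) +
    (k + 1) * k.choose i)) * h

/-- The left side collects the terms with exactly one derivative on 1/(1-αx). Here C(k,
i)(k-i)/(i+1) = C(k, i+1), and the index moves from i to i + 1. -/
lemma sum_spike_eq (γ α : ℝ) (k : ℕ) :
    ∑ i ∈ Finset.range (k + 1), (k.choose i : ℝ) * (k - i : ℕ) / (i + 1) * γ ^ (k - i - 1) * α *
      coeff i ((1 + X) ^ k * powSeries α) = spikeMoment γ α k := by
  rw [spikeMoment, Finset.sum_range_succ' (fun i => ∑ j ∈ Finset.range i,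
    (k.choose i : ℝ) * k.choose j * γ ^ (k - i) * α ^ (i - j)), Finset.sum_range_succ]
  simp only [Finset.range_zero, Finset.sum_empty, add_zero, Nat.sub_self, Nat.cast_zero, mul_zero,
    zero_div, zero_mul]
  refine Finset.sum_congr rfl fun i hi => ?_
  rw [Finset.mem_range] at hi
  have h : (k.choose i : ℝ) * (k - i : ℕ) / (i + 1) = k.choose (i + 1) := by
    rw [div_eq_iff (by positivity)]
    exact_mod_cast (Nat.choose_succ_right_eq k i).symm
  rw [h, coeff_mul, Finset.Nat.sum_antidiagonal_eq_sum_range_succ_mk, Finset.mul_sum]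
  refine Finset.sum_congr rfl fun j hj => ?_
  rw [Finset.mem_range] at hj
  rw [coeff_one_add_X_pow, powSeries, coeff_mk, show i + 1 - j = (i - j) + 1 by omega,
    show k - (i + 1) = k - i - 1 by omega]
  ring

/-- The expected power sum of mixed powers, suitably normalized. -/
noncomputable def mixedMoment (ρ : ∀ N : ℕ, PMF (Signature N)) (a i N : ℕ) : ℝ :=
  (N : ℝ)⁻¹ ^ (a + i + 1) * ∑' l : Signature N, (ρ N l).toReal *
    ∑ j, (l.shifted j : ℝ) ^ a * (descPochhammer ℝ i).eval (l.shifted j : ℝ)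

section
variable {γ α : ℝ} {ρ : ∀ N : ℕ, PMF (Signature N)}

/-- Multiplying the falling factorial of order i by x gives the one of order i + 1 plus i times
itself. Iterating trades powers for falling factorials without Stirling numbers. -/
lemma mixed_succ (N : ℕ) (l : Signature N) (a i : ℕ) : (ρ N l).toReal *
    ∑ j, (l.shifted j : ℝ) ^ (a + 1) * (descPochhammer ℝ i).eval (l.shifted j : ℝ) =
    (ρ N l).toReal * ∑ j, (l.shifted j : ℝ) ^ a *
      (descPochhammer ℝ (i + 1)).eval (l.shifted j : ℝ) + i * ((ρ N l).toReal *
    ∑ j, (l.shifted j : ℝ) ^ a * (descPochhammer ℝ i).eval (l.shifted j : ℝ)) := by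
  rw [mul_left_comm, ← mul_add, Finset.mul_sum (a := (i : ℝ)), ← Finset.sum_add_distrib]
  congr 1
  refine Finset.sum_congr rfl fun j _ => ?_
  rw [descPochhammer_succ_eval]
  ring

lemma summable_mixed (hγ : 0 ≤ γ) (hα : 0 ≤ α)
    (hρ : ∀ N : ℕ, 1 ≤ N → ∀ u : Fin N → ℂ, (∀ i, ‖u i‖ = 1) → schurGenFun (ρ N) u =
      ∏ i, Complex.exp ((γ : ℂ) * (N : ℂ) * (u i - 1)) * (1 / (1 - (α : ℂ) * (u i - 1))))
    {N : ℕ} (hN : 1 ≤ N) (a i : ℕ) : Summable fun l : Signature N => (ρ N l).toReal *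
      ∑ j, (l.shifted j : ℝ) ^ a * (descPochhammer ℝ i).eval (l.shifted j : ℝ) := by
  induction a generalizing i with
  | zero =>
    have h := hasSum_falling hN (ρ N) (c := γ * N) (by positivity) hα
      (by simpa using hρ N hN) i
    simpa using h.summable
  | succ a ih =>
    simp_rw [mixed_succ]
    exact (ih (i + 1)).add ((ih i).mul_left _)

/-- Each derivative on 1/(1-αx) carries a factor 1/N. The terms with none give the leading moment
and, through the falling factorial of N, the -k²/2 correction; those with one give the spike; the
others are negligible. -/
lemma hasExpansion_mixedMoment_zero (hγ : 0 ≤ γ) (hα : 0 ≤ α)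
    (hρ : ∀ N : ℕ, 1 ≤ N → ∀ u : Fin N → ℂ, (∀ i, ‖u i‖ = 1) → schurGenFun (ρ N) u =
      ∏ i, Complex.exp ((γ : ℂ) * (N : ℂ) * (u i - 1)) * (1 / (1 - (α : ℂ) * (u i - 1))))
    (k : ℕ) : HasExpansion (mixedMoment ρ 0 k) (limitMoment γ k)
      (spikeMoment γ α k - (k : ℝ) ^ 2 / 2 * limitMoment γ (k - 1)) := by
  have h := HasExpansion.sum (Finset.HasAntidiagonal.antidiagonal k) fun p _ =>
    HasExpansion.sum (Finset.HasAntidiagonal.antidiagonal p.2) fun q _ =>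
      ((HasExpansion.descFactorial (p.1 + 1)).mul (HasExpansion.inv_pow q.1)).const_mul
        ((k.choose p.1 : ℝ) / (p.1 + 1) * (p.2.choose q.1 * (q.1.factorial * α ^ q.1 *
          γ ^ q.2)) * coeff p.1 ((1 + X) ^ k * powSeries α ^ q.1))
  have h2 : HasExpansion (mixedMoment ρ 0 k) _ _ := h.congr' fun N hN => by
    have hs := hasSum_falling hN (ρ N) (c := γ * N) (by positivity) hα
      (by simpa using hρ N hN) k
    have hN0 : (N : ℝ) ≠ 0 := by positivity
    simp only [mixedMoment, pow_zero, one_mul, zero_add]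
    rw [hs.tsum_eq, Finset.mul_sum]
    refine Finset.sum_congr rfl fun p hp => ?_
    rw [Finset.mul_sum]
    refine Finset.sum_congr rfl fun q hq => ?_
    have hk : k + 1 = (p.1 + 1) + (q.1 + q.2) := by
      rw [Finset.HasAntidiagonal.mem_antidiagonal.1 hq,
        ← Finset.HasAntidiagonal.mem_antidiagonal.1 hp]
      ring
    have h1 : (N : ℝ)⁻¹ ^ q.2 * (γ * N) ^ q.2 = γ ^ q.2 := by
      rw [← mul_pow]; congr 1; field_simp
    rw [hk, pow_add _ (p.1 + 1), pow_add _ q.1]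
    linear_combination (-(N : ℝ)⁻¹ ^ (p.1 + 1) * (N : ℝ)⁻¹ ^ q.1 * (k.choose p.1 : ℝ) *
      ((N.descFactorial (p.1 + 1) : ℝ) / (p.1 + 1)) * p.2.choose q.1 * q.1.factorial * α ^ q.1 *
      coeff p.1 ((1 + X) ^ k * powSeries α ^ q.1)) * h1
  convert h2 using 1
  · rw [Finset.Nat.sum_antidiagonal_eq_sum_range_succ_mk, limitMoment]
    refine Finset.sum_congr rfl fun i _ => ?_
    simp only
    rw [Finset.sum_eq_single (0, k - i)]
    · simp only [Nat.choose_zero_right, Nat.factorial_zero, pow_zero, if_true, mul_one,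
        coeff_one_add_X_pow]
      push_cast
      ring
    · rintro ⟨q1, q2⟩ hq hne
      have : q1 ≠ 0 := fun h0 => hne (by
        have := Finset.HasAntidiagonal.mem_antidiagonal.1 hq
        simp only at this
        ext <;> simp <;> omega)
      simp [this]
    · intro hn
      exact absurd (Finset.HasAntidiagonal.mem_antidiagonal.2 (by simp)) hn
  · rw [Finset.Nat.sum_antidiagonal_eq_sum_range_succ_mk, ← sum_spike_eq,
      show (k : ℝ) ^ 2 / 2 * limitMoment γ (k - 1) = 1 / 2 * ((k : ℝ) ^ 2 *
        limitMoment γ (k - 1)) by ring, ← sum_sq_choose_mul, Finset.mul_sum,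
      ← Finset.sum_sub_distrib]
    refine Finset.sum_congr rfl fun i _ => ?_
    simp only
    rw [Finset.Nat.sum_antidiagonal_eq_sum_range_succ_mk, Finset.sum_range_succ']
    simp only [Nat.choose_zero_right, Nat.factorial_zero, pow_zero, if_true, mul_one,
        coeff_one_add_X_pow, Nat.sub_zero]
    rcases Nat.eq_zero_or_pos (k - i) with h0 | h0
    · rw [h0]
      simp
      field_simp
    · obtain ⟨m, hm⟩ : ∃ m, k - i = m + 1 := ⟨k - i - 1, by omega⟩
      rw [hm, Finset.sum_range_succ']
      simp
      field_simp
      ring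

lemma mixedMoment_succ (hγ : 0 ≤ γ) (hα : 0 ≤ α)
    (hρ : ∀ N : ℕ, 1 ≤ N → ∀ u : Fin N → ℂ, (∀ i, ‖u i‖ = 1) → schurGenFun (ρ N) u =
      ∏ i, Complex.exp ((γ : ℂ) * (N : ℂ) * (u i - 1)) * (1 / (1 - (α : ℂ) * (u i - 1))))
    {N : ℕ} (hN : 1 ≤ N) (a i : ℕ) : mixedMoment ρ (a + 1) i N =
      mixedMoment ρ a (i + 1) N + i * ((N : ℝ)⁻¹ * mixedMoment ρ a i N) := by
  simp only [mixedMoment]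
  simp_rw [mixed_succ]
  rw [Summable.tsum_add (summable_mixed hγ hα hρ hN a (i + 1))
    ((summable_mixed hγ hα hρ hN a i).mul_left _), tsum_mul_left]
  ring

/-- Each conversion step adds the current order i times 1/N, and a steps starting at order i add i +
(i+1) + ⋯ + (i+a-1) = a i + a(a-1)/2. At i = 0 this changes -k²/2 into -k/2. -/
lemma hasExpansion_mixedMoment (hγ : 0 ≤ γ) (hα : 0 ≤ α)
    (hρ : ∀ N : ℕ, 1 ≤ N → ∀ u : Fin N → ℂ, (∀ i, ‖u i‖ = 1) → schurGenFun (ρ N) u =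
      ∏ i, Complex.exp ((γ : ℂ) * (N : ℂ) * (u i - 1)) * (1 / (1 - (α : ℂ) * (u i - 1))))
    (a i : ℕ) : HasExpansion (mixedMoment ρ a i) (limitMoment γ (a + i))
      (spikeMoment γ α (a + i) - ((a + i : ℕ) : ℝ) ^ 2 / 2 * limitMoment γ (a + i - 1) +
        (a * i + a * (a - 1) / 2) * limitMoment γ (a + i - 1)) := by
  induction a generalizing i with
  | zero => simpa using hasExpansion_mixedMoment_zero hγ hα hρ i
  | succ a ih =>
    have h := (ih (i + 1)).add ((HasExpansion.inv.mul (ih i)).const_mul (i : ℝ))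
    have h2 := h.congr' fun N hN => (mixedMoment_succ hγ hα hρ hN a i).symm
    rw [show a + 1 + i = a + (i + 1) by ring]
    convert h2 using 1
    · ring
    · rw [show a + (i + 1) - 1 = a + i by omega]
      push_cast
      ring

lemma averagedMoment_eq (N k : ℕ) : averagedMoment (ρ N) k = mixedMoment ρ k 0 N := by
  simp only [averagedMoment, mixedMoment, powerSum, descPochhammer_zero, Polynomial.eval_one,
    mul_one, add_zero]
  rw [pow_succ', mul_assoc, ← tsum_mul_left (a := (N : ℝ)⁻¹ ^ k), one_div]
  congr 1
  refine tsum_congr fun l => ?_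
  rw [mul_left_comm, Finset.mul_sum (a := (N : ℝ)⁻¹ ^ k)]
  congr 1
  exact Finset.sum_congr rfl fun i _ => by rw [div_eq_inv_mul, mul_pow]

/-- The first two terms of the averaged moments. -/
theorem hasExpansion_averagedMoment (hγ : 0 ≤ γ) (hα : 0 ≤ α)
    (hρ : ∀ N : ℕ, 1 ≤ N → ∀ u : Fin N → ℂ, (∀ i, ‖u i‖ = 1) → schurGenFun (ρ N) u =
      ∏ i, Complex.exp ((γ : ℂ) * (N : ℂ) * (u i - 1)) * (1 / (1 - (α : ℂ) * (u i - 1))))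
    (k : ℕ) : HasExpansion (fun N => averagedMoment (ρ N) k) (limitMoment γ k)
      (spikeMoment γ α k - k / 2 * limitMoment γ (k - 1)) := by
  have h := hasExpansion_mixedMoment hγ hα hρ k 0
  simp only [averagedMoment_eq]
  convert h using 1
  rw [add_zero]
  push_cast
  ring_nf

theorem summable_powerSum (hγ : 0 ≤ γ) (hα : 0 ≤ α)
    (hρ : ∀ N : ℕ, 1 ≤ N → ∀ u : Fin N → ℂ, (∀ i, ‖u i‖ = 1) → schurGenFun (ρ N) u =
      ∏ i, Complex.exp ((γ : ℂ) * (N : ℂ) * (u i - 1)) * (1 / (1 - (α : ℂ) * (u i - 1))))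
    (k : ℕ) {N : ℕ} (hN : 1 ≤ N) :
    Summable fun l : Signature N => (ρ N l).toReal * |powerSum k l| := by
  have h := ((summable_mixed hγ hα hρ hN k 0).mul_left ((N : ℝ)⁻¹ ^ k)).abs
  refine h.congr fun l => ?_
  rw [mul_left_comm, abs_mul, abs_of_nonneg ENNReal.toReal_nonneg, Finset.mul_sum, powerSum]
  congr 2
  refine Finset.sum_congr rfl fun i _ => ?_
  rw [descPochhammer_zero, Polynomial.eval_one, mul_one, div_eq_inv_mul, mul_pow]

end

end DiscreteBBP

/-! ### Trigonometric moments, the Poisson kernel and the outlier -/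

namespace DiscreteBBP

lemma sum_range_sum_range_eq {M : Type*} [AddCommMonoid M] (a : ℕ → ℕ → M) (n : ℕ) :
    ∑ i ∈ Finset.range n, ∑ j ∈ Finset.range n, a i j =
      ∑ i ∈ Finset.range n, a i i + ∑ i ∈ Finset.range n, ∑ j ∈ Finset.range i,
        (a i j + a j i) := by
  induction n with
  | zero => simp
  | succ n ih =>
    simp only [Finset.sum_range_succ _ n, Finset.sum_add_distrib] at ih ⊢
    rw [ih]
    abel

/-- Both binomials are expanded and the terms (i, j) and (j, i) paired. The same identity serves z
on the unit circle, giving the bulk, and z = α/√γ, giving the outlier. -/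
lemma mul_inv_pow_eq {K : Type*} [Field K] (s : K) {z : K} (hz : z ≠ 0) (k : ℕ) :
    ((s + z) * (s + z⁻¹)) ^ k = ∑ i ∈ Finset.range (k + 1), (k.choose i : K) ^ 2 * (s ^ 2) ^ (k - i) +
      ∑ i ∈ Finset.range (k + 1), ∑ j ∈ Finset.range i, (k.choose i : K) * k.choose j *
        (s ^ 2) ^ (k - i) * s ^ (i - j) * (z ^ (i - j) + z⁻¹ ^ (i - j)) := by
  rw [mul_pow, add_comm s z, add_comm s z⁻¹, add_pow, add_pow, Finset.sum_mul_sum,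
    sum_range_sum_range_eq]
  congr 1
  · refine Finset.sum_congr rfl fun i _ => ?_
    have : z ^ i * z⁻¹ ^ i = 1 := by rw [← mul_pow, mul_inv_cancel₀ hz, one_pow]
    linear_combination (s ^ (k - i) * s ^ (k - i) * (k.choose i : K) ^ 2) * this
  · refine Finset.sum_congr rfl fun i hi => Finset.sum_congr rfl fun j hj => ?_
    rw [Finset.mem_range] at hi hj
    obtain ⟨d, rfl⟩ : ∃ d, i = j + d := ⟨i - j, by omega⟩
    obtain ⟨e, rfl⟩ : ∃ e, k = j + d + e := ⟨k - (j + d), by omega⟩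
    have : z ^ j * z⁻¹ ^ j = 1 := by rw [← mul_pow, mul_inv_cancel₀ hz, one_pow]
    rw [show j + d + e - (j + d) = e by omega, show j + d + e - j = d + e by omega,
      show j + d - j = d by omega, pow_add z j d, pow_add z⁻¹ j d, pow_add s d e]
    linear_combination (s ^ e * s ^ e * s ^ d * ((j + d + e).choose (j + d) : K) *
      (j + d + e).choose j * (z ^ d + z⁻¹ ^ d)) * this

/-- The parametrization of the bulk by an angle. -/
noncomputable def bulkParam (γ θ : ℝ) : ℝ := 1 + γ + 2 * √γ * Real.cos θ

lemma bulkParam_pow_eq {γ : ℝ} (hγ : 0 ≤ γ) (θ : ℝ) (k : ℕ) :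
    bulkParam γ θ ^ k = ∑ i ∈ Finset.range (k + 1), (k.choose i : ℝ) ^ 2 * γ ^ (k - i) +
      ∑ i ∈ Finset.range (k + 1), ∑ j ∈ Finset.range i, (k.choose i : ℝ) * k.choose j *
        γ ^ (k - i) * √γ ^ (i - j) * (2 * Real.cos ((i - j : ℕ) * θ)) := by
  have h := mul_inv_pow_eq (√γ : ℂ) (Complex.exp_ne_zero (θ * Complex.I)) k
  have hs : (√γ : ℂ) ^ 2 = γ := by exact_mod_cast Real.sq_sqrt hγ
  have h1 : (√γ + Complex.exp (θ * Complex.I)) * (√γ + (Complex.exp (θ * Complex.I))⁻¹) =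
      (bulkParam γ θ : ℂ) := by
    have h2 : Complex.exp (θ * Complex.I) + Complex.exp (-θ * Complex.I) =
        2 * Complex.cos θ := by rw [Complex.cos]; ring
    have h3 : Complex.exp (θ * Complex.I) * Complex.exp (-θ * Complex.I) = 1 := by
      rw [← Complex.exp_add]; simp
    rw [← Complex.exp_neg, ← neg_mul, bulkParam]
    push_cast
    linear_combination hs + (√γ : ℂ) * h2 + h3
  have h4 : ∀ n : ℕ, Complex.exp (θ * Complex.I) ^ n + (Complex.exp (θ * Complex.I))⁻¹ ^ n =
      ((2 * Real.cos (n * θ) : ℝ) : ℂ) := fun n => by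
    rw [← Complex.exp_neg, ← Complex.exp_nat_mul, ← Complex.exp_nat_mul]
    push_cast
    rw [Complex.cos]
    ring_nf
  simp_rw [h4, hs] at h
  rw [h1] at h
  exact_mod_cast h

open Real in
lemma integral_cos_int_mul (z : ℤ) :
    ∫ θ in (0 : ℝ)..π, cos (z * θ) = if z = 0 then π else 0 := by
  split_ifs with h
  · simp [h]
  · have hz : (z : ℝ) ≠ 0 := by exact_mod_cast h
    rw [intervalIntegral.integral_comp_mul_left cos hz, integral_cos]
    simp

open Real in
lemma integral_cos_mul_cos (n m : ℕ) (hm : m ≠ 0) :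
    ∫ θ in (0 : ℝ)..π, cos (n * θ) * cos (m * θ) = if n = m then π / 2 else 0 := by
  have h : ∀ θ : ℝ, cos (n * θ) * cos (m * θ) =
      1 / 2 * cos (((n - m : ℤ) : ℝ) * θ) + 1 / 2 * cos (((n + m : ℤ) : ℝ) * θ) := fun θ => by
    push_cast
    rw [sub_mul, add_mul, cos_sub, cos_add]
    ring
  simp_rw [h]
  rw [intervalIntegral.integral_add
    (Continuous.intervalIntegrable (by fun_prop) _ _)
    (Continuous.intervalIntegrable (by fun_prop) _ _), intervalIntegral.integral_const_mul,
    intervalIntegral.integral_const_mul, integral_cos_int_mul, integral_cos_int_mul,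
    if_neg (show (n + m : ℤ) ≠ 0 by omega)]
  by_cases hnm : n = m
  · rw [if_pos (by omega), if_pos hnm]; ring
  · rw [if_neg (by omega), if_neg hnm]; ring

/-- Integrals of powers against a function with known cosine coefficients. -/
lemma integral_bulkParam_pow_mul {γ : ℝ} (hγ : 0 ≤ γ) {P : ℝ → ℝ} {A : ℕ → ℝ}
    (hP : IntervalIntegrable P volume 0 Real.pi)
    (hA : ∀ n : ℕ, ∫ θ in (0 : ℝ)..Real.pi, Real.cos (n * θ) * P θ = Real.pi * A n) (k : ℕ) :
    1 / Real.pi * ∫ θ in (0 : ℝ)..Real.pi, bulkParam γ θ ^ k * P θ =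
      (∑ i ∈ Finset.range (k + 1), (k.choose i : ℝ) ^ 2 * γ ^ (k - i)) * A 0 +
      ∑ i ∈ Finset.range (k + 1), ∑ j ∈ Finset.range i, (k.choose i : ℝ) * k.choose j *
        γ ^ (k - i) * √γ ^ (i - j) * (2 * A (i - j)) := by
  have hint : ∀ n : ℕ, IntervalIntegrable (fun θ => Real.cos (n * θ) * P θ) volume 0 Real.pi :=
    fun n => hP.continuousOn_mul (Continuous.continuousOn (by fun_prop))
  have h0 : ∫ θ in (0 : ℝ)..Real.pi, P θ = Real.pi * A 0 := by simpa using hA 0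
  have hexp : ∀ θ, bulkParam γ θ ^ k * P θ =
      (∑ i ∈ Finset.range (k + 1), (k.choose i : ℝ) ^ 2 * γ ^ (k - i)) * P θ +
      ∑ i ∈ Finset.range (k + 1), ∑ j ∈ Finset.range i, (k.choose i : ℝ) * k.choose j *
        γ ^ (k - i) * √γ ^ (i - j) * 2 * (Real.cos ((i - j : ℕ) * θ) * P θ) := fun θ => by
    rw [bulkParam_pow_eq hγ, add_mul]
    congr 1
    rw [Finset.sum_mul]
    refine Finset.sum_congr rfl fun i _ => ?_
    rw [Finset.sum_mul]
    exact Finset.sum_congr rfl fun j _ => by ring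
  have hi2 : ∀ i j : ℕ, IntervalIntegrable (fun θ => (k.choose i : ℝ) * k.choose j *
        γ ^ (k - i) * √γ ^ (i - j) * 2 * (Real.cos ((i - j : ℕ) * θ) * P θ)) volume 0 Real.pi :=
    fun i j => (hint _).const_mul _
  have hi3 : ∀ i : ℕ, IntervalIntegrable (fun θ => ∑ j ∈ Finset.range i,
      (k.choose i : ℝ) * k.choose j * γ ^ (k - i) * √γ ^ (i - j) * 2 *
        (Real.cos ((i - j : ℕ) * θ) * P θ)) volume 0 Real.pi := fun i => by
    have := IntervalIntegrable.sum (Finset.range i) fun j (_ : j ∈ Finset.range i) => hi2 i j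
    simpa only [Finset.sum_fn] using this
  have hi4 : IntervalIntegrable (fun θ => ∑ i ∈ Finset.range (k + 1), ∑ j ∈ Finset.range i,
      (k.choose i : ℝ) * k.choose j * γ ^ (k - i) * √γ ^ (i - j) * 2 *
        (Real.cos ((i - j : ℕ) * θ) * P θ)) volume 0 Real.pi := by
    have := IntervalIntegrable.sum (Finset.range (k + 1))
      fun i (_ : i ∈ Finset.range (k + 1)) => hi3 i
    simpa only [Finset.sum_fn] using this
  simp_rw [hexp]
  rw [intervalIntegral.integral_add (hP.const_mul _) hi4, intervalIntegral.integral_const_mul,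
    h0, intervalIntegral.integral_finsetSum fun i _ => hi3 i, mul_add]
  congr 1
  · field_simp
  · rw [Finset.mul_sum]
    refine Finset.sum_congr rfl fun i _ => ?_
    rw [intervalIntegral.integral_finsetSum fun j _ => hi2 i j, Finset.mul_sum]
    refine Finset.sum_congr rfl fun j _ => ?_
    rw [intervalIntegral.integral_const_mul, hA]
    field_simp

/-- The oscillating part `∑_{m ≥ 1} r ^ m cos (m θ)` of the Poisson kernel in closed form. -/
noncomputable def poissonPart (r θ : ℝ) : ℝ :=
  (r * Real.cos θ - r ^ 2) / (1 + r ^ 2 - 2 * r * Real.cos θ)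

lemma one_add_sq_sub_pos {r : ℝ} (hr : 0 ≤ r) (hr1 : r ≠ 1) (θ : ℝ) :
    0 < 1 + r ^ 2 - 2 * r * Real.cos θ := by
  have h1 : 0 < (1 - r) ^ 2 := by
    have : 1 - r ≠ 0 := sub_ne_zero.2 hr1.symm
    positivity
  nlinarith [Real.cos_le_one θ, mul_nonneg hr (sub_nonneg.2 (Real.cos_le_one θ))]

lemma continuous_poissonPart {r : ℝ} (hr : 0 ≤ r) (hr1 : r ≠ 1) : Continuous (poissonPart r) := by
  unfold poissonPart
  exact Continuous.div (by fun_prop) (by fun_prop) fun θ => (one_add_sq_sub_pos hr hr1 θ).ne'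

lemma hasSum_poissonPart {r : ℝ} (hr : 0 ≤ r) (hr1 : r < 1) (θ : ℝ) :
    HasSum (fun m : ℕ => r ^ (m + 1) * Real.cos ((m + 1 : ℕ) * θ)) (poissonPart r θ) := by
  set z : ℂ := r * Complex.exp (θ * Complex.I) with hz
  have hn : ‖z‖ < 1 := by
    rw [hz, norm_mul, Complex.norm_exp_ofReal_mul_I, mul_one, Complex.norm_real,
      Real.norm_of_nonneg hr]
    exact hr1
  have h := Complex.hasSum_re ((hasSum_geometric_of_norm_lt_one hn).mul_left z)
  convert h using 1
  · ext m
    rw [← pow_succ', hz, mul_pow, ← Complex.exp_nat_mul, ← mul_assoc, ← Complex.ofReal_pow,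
      Complex.re_ofReal_mul]
    congr 1
    rw [show ((m + 1 : ℕ) : ℂ) * θ = (((m + 1 : ℕ) * θ : ℝ) : ℂ) by push_cast; rfl,
      Complex.exp_ofReal_mul_I_re]
  · have hre : z.re = r * Real.cos θ := by
      rw [hz, Complex.re_ofReal_mul, Complex.exp_ofReal_mul_I_re]
    have him : z.im = r * Real.sin θ := by
      rw [hz, Complex.im_ofReal_mul, Complex.exp_ofReal_mul_I_im]
    have hpos := one_add_sq_sub_pos hr hr1.ne θ
    have hsq := Real.sin_sq_add_cos_sq θ
    have hns : Complex.normSq (1 - z) = 1 + r ^ 2 - 2 * r * Real.cos θ := by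
      rw [Complex.normSq_apply, Complex.sub_re, Complex.sub_im, hre, him, Complex.one_re,
        Complex.one_im]
      linear_combination r ^ 2 * hsq
    rw [Complex.mul_re, Complex.inv_re, Complex.inv_im, hns, Complex.sub_re, Complex.sub_im, hre,
      him, Complex.one_re, Complex.one_im, poissonPart]
    linear_combination (r ^ 2 / (1 + r ^ 2 - 2 * r * Real.cos θ)) * hsq

/-- The cosine coefficients of `poissonPart`. -/
noncomputable def poissonCoeff (r : ℝ) (n : ℕ) : ℝ :=
  if r < 1 then (if n = 0 then 0 else r ^ n / 2)
  else if r = 1 then (if n = 0 then -1 / 2 else 0)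
  else if n = 0 then -1 else -(r⁻¹ ^ n / 2)

lemma integral_cos_mul_poissonPart_of_lt {r : ℝ} (hr : 0 ≤ r) (hr1 : r < 1) (n : ℕ) :
    ∫ θ in (0 : ℝ)..Real.pi, Real.cos (n * θ) * poissonPart r θ =
      Real.pi * if n = 0 then 0 else r ^ n / 2 := by
  have h1 : ∀ θ, HasSum (fun m : ℕ => r ^ (m + 1) * (Real.cos (n * θ) *
      Real.cos ((m + 1 : ℕ) * θ))) (Real.cos (n * θ) * poissonPart r θ) := fun θ => by
    have h := (hasSum_poissonPart hr hr1 θ).mul_left (Real.cos (n * θ))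
    simp only [mul_left_comm (Real.cos (n * θ)) (r ^ _)] at h
    exact h
  have h2 := intervalIntegral.hasSum_integral_of_dominated_convergence
    (μ := volume) (a := 0) (b := Real.pi) (fun (m : ℕ) (_ : ℝ) => r ^ (m + 1))
    (F := fun (m : ℕ) θ => r ^ (m + 1) * (Real.cos (n * θ) * Real.cos ((m + 1 : ℕ) * θ)))
    (fun m => (Continuous.aestronglyMeasurable (by fun_prop)))
    (fun m => Eventually.of_forall fun θ _ => by
      rw [norm_mul, norm_mul, Real.norm_of_nonneg (by positivity)]
      refine mul_le_of_le_one_right (by positivity) ?_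
      exact mul_le_one₀ (Real.abs_cos_le_one _) (norm_nonneg _) (Real.abs_cos_le_one _))
    (Eventually.of_forall fun θ _ => (summable_nat_add_iff 1).2
      (summable_geometric_of_lt_one hr hr1))
    (by simp) (Eventually.of_forall fun θ _ => h1 θ)
  rw [← h2.tsum_eq]
  have h3 : ∀ m : ℕ, ∫ θ in (0 : ℝ)..Real.pi, r ^ (m + 1) * (Real.cos (n * θ) *
      Real.cos ((m + 1 : ℕ) * θ)) = r ^ (m + 1) * if n = m + 1 then Real.pi / 2 else 0 :=
    fun m => by
      rw [intervalIntegral.integral_const_mul, integral_cos_mul_cos n (m + 1) (by omega)]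
  simp_rw [h3]
  rcases n with _ | n
  · simp
  · rw [tsum_eq_single n fun m hm => by rw [if_neg (by omega), mul_zero]]
    simp
    ring

/-- At the critical value numerator and denominator are proportional. The endpoint θ = 0, where the
quotient is 0/0, has to be left out. -/
lemma poissonPart_one {θ : ℝ} (hθ : θ ∈ Set.Ioo 0 Real.pi) : poissonPart 1 θ = -1 / 2 := by
  have h : Real.cos θ < 1 := by
    rw [← Real.cos_zero]
    exact Real.cos_lt_cos_of_nonneg_of_le_pi le_rfl hθ.2.le hθ.1
  have h2 : 1 + 1 ^ 2 - 2 * 1 * Real.cos θ ≠ 0 := by linarith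
  rw [poissonPart, div_eq_div_iff h2 two_ne_zero]
  ring

/-- The full Poisson kernel 1 + 2 `poissonPart` equals (1-r²)/(1+r²-2r cos θ), which changes sign
under r ↦ 1/r. The supercritical case reduces to the convergent series this way. -/
lemma poissonPart_eq_neg_one_sub {r : ℝ} (hr : 1 < r) (θ : ℝ) :
    poissonPart r θ = -1 - poissonPart r⁻¹ θ := by
  have h0 : r ≠ 0 := by linarith
  have h1 := (one_add_sq_sub_pos (by linarith) hr.ne' θ).ne'
  have h2 := (one_add_sq_sub_pos (inv_nonneg.2 (by linarith))
    (inv_lt_one_of_one_lt₀ hr).ne θ).ne'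
  have h3 : 1 + r⁻¹ ^ 2 - 2 * r⁻¹ * Real.cos θ =
      (1 + r ^ 2 - 2 * r * Real.cos θ) / r ^ 2 := by
    field_simp
    ring
  have h4 : poissonPart r⁻¹ θ = (r * Real.cos θ - 1) / (1 + r ^ 2 - 2 * r * Real.cos θ) := by
    rw [poissonPart, h3]
    field_simp
  rw [h4, poissonPart, eq_sub_iff_add_eq, ← add_div, div_eq_iff h1]
  ring

lemma intervalIntegrable_poissonPart {r : ℝ} (hr : 0 ≤ r) :
    IntervalIntegrable (poissonPart r) volume 0 Real.pi := by
  by_cases h : r = 1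
  · rw [h, intervalIntegrable_iff_integrableOn_Ioo_of_le Real.pi_pos.le]
    exact (integrableOn_congr_fun (fun θ hθ => poissonPart_one hθ) measurableSet_Ioo).2
      (integrableOn_const (by simp))
  · exact (continuous_poissonPart hr h).intervalIntegrable _ _

lemma integral_cos_mul_poissonPart {r : ℝ} (hr : 0 ≤ r) (n : ℕ) :
    ∫ θ in (0 : ℝ)..Real.pi, Real.cos (n * θ) * poissonPart r θ =
      Real.pi * poissonCoeff r n := by
  have hconst : ∫ θ in (0 : ℝ)..Real.pi, Real.cos (n * θ) = if n = 0 then Real.pi else 0 := by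
    simpa using integral_cos_int_mul n
  rw [poissonCoeff]
  split_ifs with h1 h0 h2 h0 h0
  · simpa [h0] using integral_cos_mul_poissonPart_of_lt hr h1 n
  · simpa [h0] using integral_cos_mul_poissonPart_of_lt hr h1 n
  · have h3 : ∫ θ in (0 : ℝ)..Real.pi, Real.cos (n * θ) * poissonPart r θ =
        ∫ θ in (0 : ℝ)..Real.pi, Real.cos (n * θ) * (-1 / 2) := by
      refine intervalIntegral.integral_congr_Ioo_of_le Real.pi_pos.le fun θ hθ => ?_
      simp only [h2, poissonPart_one hθ]
    rw [h3, intervalIntegral.integral_mul_const, hconst, if_pos h0]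
  · have h3 : ∫ θ in (0 : ℝ)..Real.pi, Real.cos (n * θ) * poissonPart r θ =
        ∫ θ in (0 : ℝ)..Real.pi, Real.cos (n * θ) * (-1 / 2) := by
      refine intervalIntegral.integral_congr_Ioo_of_le Real.pi_pos.le fun θ hθ => ?_
      simp only [h2, poissonPart_one hθ]
    rw [h3, intervalIntegral.integral_mul_const, hconst, if_neg h0, zero_mul, mul_zero]
  all_goals
    have hr1 : 1 < r := lt_of_le_of_ne (not_lt.1 h1) (Ne.symm h2)
    have hi1 : r⁻¹ < 1 := inv_lt_one_of_one_lt₀ hr1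
    have hi0 : 0 ≤ r⁻¹ := inv_nonneg.2 hr
    have h3 : ∀ θ, Real.cos (n * θ) * poissonPart r θ =
        -Real.cos (n * θ) - Real.cos (n * θ) * poissonPart r⁻¹ θ := fun θ => by
      rw [poissonPart_eq_neg_one_sub hr1]
      ring
    simp_rw [h3]
    rw [intervalIntegral.integral_sub (Continuous.intervalIntegrable (by fun_prop) _ _)
      (Continuous.intervalIntegrable (u := fun θ => Real.cos (n * θ) * poissonPart r⁻¹ θ)
        (Continuous.mul (by fun_prop) (continuous_poissonPart hi0 hi1.ne)) _ _),
      intervalIntegral.integral_neg, hconst, integral_cos_mul_poissonPart_of_lt hi0 hi1]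
    simp [h0]

/-- Moments of `(1 / π) (1 + √γ cos θ)` under the parametrization of the bulk. -/
lemma integral_bulkParam_pow_mul_one_add {γ : ℝ} (hγ : 0 ≤ γ) (k : ℕ) :
    1 / Real.pi * ∫ θ in (0 : ℝ)..Real.pi, bulkParam γ θ ^ k * (1 + √γ * Real.cos θ) =
      (k + 1) * limitMoment γ k := by
  rw [integral_bulkParam_pow_mul hγ (A := fun n => (if n = 0 then 1 else 0) +
    if n = 1 then √γ / 2 else 0) (Continuous.intervalIntegrable (by fun_prop) _ _)]
  · have h1 : ∀ i ∈ Finset.range k, ∑ j ∈ Finset.range (i + 1),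
        (k.choose (i + 1) : ℝ) * k.choose j * γ ^ (k - (i + 1)) * √γ ^ (i + 1 - j) *
          (2 * ((if i + 1 - j = 0 then 1 else 0) + if i + 1 - j = 1 then √γ / 2 else 0)) =
        (k.choose (i + 1) : ℝ) * k.choose i * γ ^ (k - i) := fun i hi => by
      rw [Finset.mem_range] at hi
      rw [Finset.sum_range_succ, Finset.sum_eq_zero, Nat.add_sub_cancel_left, zero_add,
        if_neg one_ne_zero, if_pos rfl, show k - i = k - (i + 1) + 1 by omega]
      · linear_combination (k.choose (i + 1) : ℝ) * k.choose i * γ ^ (k - (i + 1)) *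
          Real.sq_sqrt hγ
      · intro j hj
        rw [Finset.mem_range] at hj
        rw [if_neg (by omega), if_neg (by omega)]
        simp
    rw [Finset.sum_range_succ' (n := k) (fun i => ∑ j ∈ Finset.range i, _),
      Finset.sum_congr rfl h1, Finset.sum_range_zero, add_zero, limitMoment, Finset.mul_sum]
    have h2 : ∑ i ∈ Finset.range k, (k.choose (i + 1) : ℝ) * k.choose i * γ ^ (k - i) =
        ∑ i ∈ Finset.range (k + 1), (k.choose (i + 1) : ℝ) * k.choose i * γ ^ (k - i) := by
      rw [Finset.sum_range_succ]
      simp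
    simp only [if_true, zero_ne_one, if_false, add_zero, mul_one]
    rw [h2, ← Finset.sum_add_distrib]
    refine Finset.sum_congr rfl fun i _ => ?_
    have h3 : ((k + 1).choose (i + 1) : ℝ) * (i + 1) = (k + 1) * k.choose i := by
      exact_mod_cast (Nat.add_one_mul_choose_eq k i).symm
    have h4 : ((k + 1).choose (i + 1) : ℝ) = k.choose i + k.choose (i + 1) := by
      exact_mod_cast Nat.choose_succ_succ k i
    rw [h4] at h3
    field_simp
    linear_combination (k.choose i : ℝ) * γ ^ (k - i) * h3
  · intro n
    have h1 : ∀ θ : ℝ, Real.cos (n * θ) * (1 + √γ * Real.cos θ) = Real.cos ((n : ℤ) * θ) +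
        √γ * (Real.cos (n * θ) * Real.cos ((1 : ℕ) * θ)) := fun θ => by
      push_cast
      rw [one_mul]
      ring
    simp_rw [h1]
    rw [intervalIntegral.integral_add (Continuous.intervalIntegrable (by fun_prop) _ _)
      (Continuous.intervalIntegrable (by fun_prop) _ _), intervalIntegral.integral_const_mul,
      integral_cos_int_mul, integral_cos_mul_cos n 1 one_ne_zero]
    simp only [Int.natCast_eq_zero]
    split_ifs <;> ring

/-- Moments of `poissonPart` complemented by the outlier. -/
lemma integral_bulkParam_pow_mul_poissonPart {γ α : ℝ} (hγ : 0 < γ) (hα : 0 ≤ α) (k : ℕ) :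
    1 / Real.pi * (∫ θ in (0 : ℝ)..Real.pi, bulkParam γ θ ^ k * poissonPart (α / √γ) θ) +
      outlierMass γ α * outlier γ α ^ k = spikeMoment γ α k := by
  have hs : 0 < √γ := Real.sqrt_pos.2 hγ
  have hs2 : √γ ^ 2 = γ := Real.sq_sqrt hγ.le
  have hr : 0 ≤ α / √γ := div_nonneg hα hs.le
  have hsr : √γ * (α / √γ) = α := by field_simp
  rw [integral_bulkParam_pow_mul hγ.le (intervalIntegrable_poissonPart hr)
    (integral_cos_mul_poissonPart hr), spikeMoment]
  -- The outlier is (√γ + z)(√γ + z⁻¹) at z = α/√γ.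
  have hout : α ≠ 0 → outlier γ α ^ k =
      ∑ i ∈ Finset.range (k + 1), (k.choose i : ℝ) ^ 2 * γ ^ (k - i) +
      ∑ i ∈ Finset.range (k + 1), ∑ j ∈ Finset.range i, (k.choose i : ℝ) * k.choose j *
        γ ^ (k - i) * √γ ^ (i - j) * ((α / √γ) ^ (i - j) + (α / √γ)⁻¹ ^ (i - j)) := fun h => by
    have h1 := mul_inv_pow_eq (√γ) (div_ne_zero h hs.ne') k
    rw [hs2] at h1
    rw [← h1, outlier]
    congr 1
    field_simp
    rw [hs2]
    ring
  have hα' : ∀ i j, α ^ (i - j) = √γ ^ (i - j) * (α / √γ) ^ (i - j) := fun i j => by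
    rw [← mul_pow, hsr]
  have hd : ∀ i, ∀ j ∈ Finset.range i, i - j ≠ 0 := fun i j hj => by
    rw [Finset.mem_range] at hj
    omega
  rcases lt_trichotomy α (√γ) with h | h | h
  · have h1 : α / √γ < 1 := (div_lt_one hs).2 h
    rw [outlierMass, if_neg h.not_gt, if_neg h.ne, zero_mul, add_zero]
    simp only [poissonCoeff, if_pos h1, if_true, mul_zero, zero_add]
    refine Finset.sum_congr rfl fun i _ => Finset.sum_congr rfl fun j hj => ?_
    rw [if_neg (hd i j hj), hα']
    ring
  · have h1 : α / √γ = 1 := by rw [h, div_self hs.ne']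
    rw [outlierMass, if_neg h.not_gt, if_pos h, hout (h ▸ hs.ne')]
    -- At z = 1 each pair z^m + z^(-m) is 2, so half an atom gives the off-diagonal sum exactly. Its
    -- diagonal half cancels the coefficient -1/2 at n = 0.
    simp only [poissonCoeff, h1, lt_irrefl, if_false, if_true]
    rw [Finset.sum_eq_zero fun i _ => Finset.sum_eq_zero fun j hj => by
      rw [if_neg (hd i j hj), mul_zero, mul_zero]]
    have h2 : ∑ i ∈ Finset.range (k + 1), ∑ j ∈ Finset.range i, (k.choose i : ℝ) * k.choose j *
        γ ^ (k - i) * √γ ^ (i - j) * (1 ^ (i - j) + 1⁻¹ ^ (i - j)) =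
        2 * ∑ i ∈ Finset.range (k + 1), ∑ j ∈ Finset.range i, (k.choose i : ℝ) * k.choose j *
          γ ^ (k - i) * α ^ (i - j) := by
      simp_rw [Finset.mul_sum, h]
      refine Finset.sum_congr rfl fun i _ => Finset.sum_congr rfl fun j _ => ?_
      rw [inv_one, one_pow]
      ring
    rw [h2]
    ring
  · have h1 : 1 < α / √γ := (one_lt_div hs).2 h
    rw [outlierMass, if_pos h, hout (hs.trans h).ne']
    simp only [poissonCoeff, if_neg h1.not_gt, if_neg h1.ne', if_true]
    -- The atom's diagonal cancels the coefficient -1 at n = 0, and its terms r^(-m) cancel those of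
    -- the density, leaving r^m as in the subcritical case.
    rw [one_mul, add_add_add_comm, mul_neg_one, neg_add_cancel, zero_add,
      ← Finset.sum_add_distrib]
    refine Finset.sum_congr rfl fun i _ => ?_
    rw [← Finset.sum_add_distrib]
    refine Finset.sum_congr rfl fun j hj => ?_
    rw [if_neg (hd i j hj), hα']
    ring

end DiscreteBBP

/-! ### The densities on the bulk -/

namespace DiscreteBBP

/-- The arcsine density of the bulk. -/
noncomputable def bulkWeight (γ t : ℝ) : ℝ :=
  1 / (2 * Real.pi * √((γ + 1 + 2 * √γ - t) * (t - γ - 1 + 2 * √γ)))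

/-- The density of the limit measure. -/
noncomputable def limitDensity (γ t : ℝ) : ℝ :=
  1 / Real.pi * Real.arccos ((t - 1 + γ) / (2 * √(γ * t)))

lemma bulkParam_image_Ioo {γ : ℝ} (hγ : 0 < γ) :
    bulkParam γ '' Set.Ioo 0 Real.pi = Set.Ioo ((√γ - 1) ^ 2) ((√γ + 1) ^ 2) := by
  have hs : 0 < √γ := Real.sqrt_pos.2 hγ
  have hs2 : √γ ^ 2 = γ := Real.sq_sqrt hγ.le
  ext t
  constructor
  · rintro ⟨θ, hθ, rfl⟩
    have h1 : Real.cos θ < 1 := by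
      rw [← Real.cos_zero]
      exact Real.cos_lt_cos_of_nonneg_of_le_pi le_rfl hθ.2.le hθ.1
    have h2 : -1 < Real.cos θ := by
      rw [← Real.cos_pi]
      exact Real.cos_lt_cos_of_nonneg_of_le_pi hθ.1.le le_rfl hθ.2
    rw [bulkParam]
    constructor <;> nlinarith
  · rintro ⟨h1, h2⟩
    have h3 : -1 < (t - 1 - γ) / (2 * √γ) := by rw [lt_div_iff₀ (by positivity)]; nlinarith
    have h4 : (t - 1 - γ) / (2 * √γ) < 1 := by rw [div_lt_iff₀ (by positivity)]; nlinarith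
    refine ⟨Real.arccos ((t - 1 - γ) / (2 * √γ)), ⟨Real.arccos_pos.2 h4, ?_⟩, ?_⟩
    · exact lt_of_le_of_ne (Real.arccos_le_pi _) fun h => (Real.arccos_eq_pi.1 h).not_gt h3
    · rw [bulkParam, Real.cos_arccos h3.le h4.le]
      field_simp
      ring

lemma injOn_bulkParam {γ : ℝ} (hγ : 0 < γ) : Set.InjOn (bulkParam γ) (Set.Ioo 0 Real.pi) := by
  have hs : 0 < √γ := Real.sqrt_pos.2 hγ
  intro x hx y hy hxy
  refine Real.injOn_cos (Set.Ioo_subset_Icc_self hx) (Set.Ioo_subset_Icc_self hy) ?_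
  simp only [bulkParam] at hxy
  have : 2 * √γ * (Real.cos x - Real.cos y) = 0 := by linarith
  rcases mul_eq_zero.1 this with h | h
  · linarith
  · linarith

lemma hasDerivAt_bulkParam (γ θ : ℝ) :
    HasDerivAt (bulkParam γ) (-(2 * √γ * Real.sin θ)) θ := by
  have := ((Real.hasDerivAt_cos θ).const_mul (2 * √γ)).const_add (1 + γ)
  rwa [mul_neg] at this

/-- The quantity under the root is the square of the Jacobian 2√γ sin θ: the weight is the image of
a constant density in θ. -/
lemma abs_mul_bulkWeight {γ : ℝ} (hγ : 0 < γ) {θ : ℝ} (hθ : θ ∈ Set.Ioo 0 Real.pi) :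
    |-(2 * √γ * Real.sin θ)| * bulkWeight γ (bulkParam γ θ) = 1 / (2 * Real.pi) := by
  have hs : 0 < √γ := Real.sqrt_pos.2 hγ
  have hsin : 0 < Real.sin θ := Real.sin_pos_of_mem_Ioo hθ
  have h1 : (γ + 1 + 2 * √γ - bulkParam γ θ) * (bulkParam γ θ - γ - 1 + 2 * √γ) =
      (2 * √γ * Real.sin θ) ^ 2 := by
    rw [bulkParam]
    linear_combination (-(2 * √γ) ^ 2) * Real.sin_sq_add_cos_sq θ
  rw [bulkWeight, h1, abs_neg, Real.sqrt_sq_eq_abs, abs_of_pos (by positivity)]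
  field_simp

lemma bulk_ae_eq_image {γ : ℝ} (hγ : 0 < γ) :
    (bulk γ : Set ℝ) =ᵐ[volume] bulkParam γ '' Set.Ioo 0 Real.pi := by
  rw [bulkParam_image_Ioo hγ]
  exact Ioo_ae_eq_Icc.symm

lemma integral_bulk_mul_bulkWeight {γ : ℝ} (hγ : 0 < γ) (g : ℝ → ℝ) :
    ∫ t in bulk γ, g t * bulkWeight γ t =
      1 / (2 * Real.pi) * ∫ θ in (0 : ℝ)..Real.pi, g (bulkParam γ θ) := by
  rw [setIntegral_congr_set (bulk_ae_eq_image hγ),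
    integral_image_eq_integral_abs_deriv_smul measurableSet_Ioo
      (fun θ _ => (hasDerivAt_bulkParam γ θ).hasDerivWithinAt) (injOn_bulkParam hγ),
    intervalIntegral.integral_of_le Real.pi_pos.le, integral_Ioc_eq_integral_Ioo,
    ← integral_const_mul]
  refine setIntegral_congr_fun measurableSet_Ioo fun θ hθ => ?_
  rw [smul_eq_mul, mul_left_comm, abs_mul_bulkWeight hγ hθ, mul_comm]

lemma integrableOn_bulk_mul_bulkWeight_iff {γ : ℝ} (hγ : 0 < γ) (g : ℝ → ℝ) :
    IntegrableOn (fun t => g t * bulkWeight γ t) (bulk γ) ↔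
      IntervalIntegrable (fun θ => g (bulkParam γ θ)) volume 0 Real.pi := by
  rw [integrableOn_congr_set_ae (bulk_ae_eq_image hγ),
    integrableOn_image_iff_integrableOn_abs_deriv_smul measurableSet_Ioo
      (fun θ _ => (hasDerivAt_bulkParam γ θ).hasDerivWithinAt) (injOn_bulkParam hγ),
    intervalIntegrable_iff_integrableOn_Ioo_of_le Real.pi_pos.le,
    integrableOn_congr_fun (g := fun θ => 1 / (2 * Real.pi) * g (bulkParam γ θ))
      (fun θ hθ => ?_) measurableSet_Ioo]
  · exact integrable_const_mul_iff (IsUnit.mk0 _ (by positivity)) _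
  · simp only [smul_eq_mul]
    rw [mul_left_comm, abs_mul_bulkWeight hγ hθ, mul_comm]

lemma bulkParam_pos {γ : ℝ} (hγ : 1 < γ) (θ : ℝ) : 0 < bulkParam γ θ := by
  have hs : 1 < √γ := Real.lt_sqrt_of_sq_lt (by simpa using hγ)
  have hs2 : √γ ^ 2 = γ := Real.sq_sqrt (by linarith)
  rw [bulkParam]
  nlinarith [Real.neg_one_le_cos θ, mul_pos (sub_pos.2 hs) (sub_pos.2 hs)]

lemma continuous_bulkParam (γ : ℝ) : Continuous (bulkParam γ) := by
  unfold bulkParam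
  fun_prop

/-- With α = √γ r, numerator and denominator share the factor γ, and what remains is the Poisson
kernel. -/
lemma rational_part_bulkParam {γ : ℝ} (hγ : 0 < γ) (α θ : ℝ) :
    α * (bulkParam γ θ - 2 * α - γ - 1) /
      (γ + α ^ 2 + α * γ + α - α * bulkParam γ θ) = 2 * poissonPart (α / √γ) θ := by
  have hs : 0 < √γ := Real.sqrt_pos.2 hγ
  have hs2 : √γ ^ 2 = γ := Real.sq_sqrt hγ.le
  obtain ⟨r, hr⟩ : ∃ r, r = α / √γ := ⟨_, rfl⟩
  have hα : α = √γ * r := by rw [hr]; field_simp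
  have h1 : α * (bulkParam γ θ - 2 * α - γ - 1) = γ * (2 * (r * Real.cos θ - r ^ 2)) := by
    rw [bulkParam, hα]
    linear_combination (2 * r * Real.cos θ - 2 * r ^ 2) * hs2
  have h2 : γ + α ^ 2 + α * γ + α - α * bulkParam γ θ =
      γ * (1 + r ^ 2 - 2 * r * Real.cos θ) := by
    rw [bulkParam, hα]
    linear_combination (r ^ 2 - 2 * r * Real.cos θ) * hs2
  rw [← hr, h1, h2, mul_div_mul_left _ _ hγ.ne', poissonPart, mul_div_assoc]

/-- The arcsine weighted density whose antiderivative is the limit density. -/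
noncomputable def driftDensity (γ t : ℝ) : ℝ := (t + 1 - γ) / (2 * t) * bulkWeight γ t

lemma integrableOn_pow_mul_driftDensity {γ : ℝ} (hγ : 1 < γ) (k : ℕ) :
    IntegrableOn (fun t => t ^ k * driftDensity γ t) (bulk γ) := by
  simp only [driftDensity, ← mul_assoc]
  rw [integrableOn_bulk_mul_bulkWeight_iff (by linarith)
    (fun t => t ^ k * ((t + 1 - γ) / (2 * t)))]
  have h := continuous_bulkParam γ
  refine Continuous.intervalIntegrable ((h.pow k).mul
    (Continuous.div (by fun_prop) (by fun_prop) fun θ => ?_)) _ _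
  have := bulkParam_pos hγ θ
  positivity

lemma integral_pow_succ_mul_driftDensity {γ : ℝ} (hγ : 1 < γ) (k : ℕ) :
    ∫ t in bulk γ, t ^ (k + 1) * driftDensity γ t = (k + 1) / 2 * limitMoment γ k := by
  simp only [driftDensity, ← mul_assoc]
  rw [integral_bulk_mul_bulkWeight (by linarith)
    (fun t => t ^ (k + 1) * ((t + 1 - γ) / (2 * t)))]
  have h : ∀ θ, bulkParam γ θ ^ (k + 1) * ((bulkParam γ θ + 1 - γ) / (2 * bulkParam γ θ)) =
      bulkParam γ θ ^ k * (1 + √γ * Real.cos θ) := fun θ => by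
    have h0 := (bulkParam_pos hγ θ).ne'
    have h1 : bulkParam γ θ + 1 - γ = 2 * (1 + √γ * Real.cos θ) := by rw [bulkParam]; ring
    rw [h1, pow_succ]
    field_simp
  simp_rw [h]
  have := integral_bulkParam_pow_mul_one_add (γ := γ) (by linarith) k
  linear_combination 1 / 2 * this

lemma sqrt_one_lt {γ : ℝ} (hγ : 1 < γ) : 1 < √γ := Real.lt_sqrt_of_sq_lt (by simpa using hγ)

lemma pos_of_mem_bulk {γ : ℝ} (hγ : 1 < γ) {t : ℝ} (ht : t ∈ bulk γ) : 0 < t :=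
  lt_of_lt_of_le (pow_pos (sub_pos.2 (sqrt_one_lt hγ)) 2) ht.1

lemma continuousOn_limitDensity {γ : ℝ} (hγ : 1 < γ) : ContinuousOn (limitDensity γ) (bulk γ) := by
  unfold limitDensity
  refine continuousOn_const.mul (Real.continuous_arccos.comp_continuousOn
    (ContinuousOn.div (by fun_prop) (by fun_prop) fun t ht => ?_))
  have h1 := pos_of_mem_bulk hγ ht
  have h2 : 0 < γ * t := by positivity
  positivity

/-- For γ > 1 the root of (√γ-1)² is √γ - 1, so the argument of arccos is 1 rather than -1 and the
integration by parts has no boundary term. -/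
lemma limitDensity_left {γ : ℝ} (hγ : 1 < γ) : limitDensity γ ((√γ - 1) ^ 2) = 0 := by
  have hs := sqrt_one_lt hγ
  have hs2 : √γ ^ 2 = γ := Real.sq_sqrt (by linarith)
  have h : ((√γ - 1) ^ 2 - 1 + γ) / (2 * √(γ * (√γ - 1) ^ 2)) = 1 := by
    rw [Real.sqrt_mul (by linarith), Real.sqrt_sq (by linarith), div_eq_one_iff_eq]
    · linear_combination -hs2
    · have : 0 < √γ - 1 := by linarith
      positivity
  rw [limitDensity, h, Real.arccos_one, mul_zero]

lemma limitDensity_right {γ : ℝ} (hγ : 1 < γ) : limitDensity γ ((√γ + 1) ^ 2) = 0 := by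
  have hs := sqrt_one_lt hγ
  have hs2 : √γ ^ 2 = γ := Real.sq_sqrt (by linarith)
  have h : ((√γ + 1) ^ 2 - 1 + γ) / (2 * √(γ * (√γ + 1) ^ 2)) = 1 := by
    rw [Real.sqrt_mul (by linarith), Real.sqrt_sq (by linarith), div_eq_one_iff_eq]
    · linear_combination -hs2
    · positivity
  rw [limitDensity, h, Real.arccos_one, mul_zero]

lemma hasDerivAt_limitDensity {γ t : ℝ} (hγ : 1 < γ)
    (ht : t ∈ Set.Ioo ((√γ - 1) ^ 2) ((√γ + 1) ^ 2)) :
    HasDerivAt (limitDensity γ) (-2 * driftDensity γ t) t := by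
  have hs := sqrt_one_lt hγ
  have hs2 : √γ ^ 2 = γ := Real.sq_sqrt (by linarith)
  have ht0 : 0 < t := pos_of_mem_bulk hγ (Set.Ioo_subset_Icc_self ht)
  have hq : 0 < √t := Real.sqrt_pos.2 ht0
  have hq2 : √t ^ 2 = t := Real.sq_sqrt ht0.le
  have hγ0 : 0 < √γ := by linarith
  have hpos : 0 < (γ + 1 + 2 * √γ - t) * (t - γ - 1 + 2 * √γ) :=
    mul_pos (by nlinarith [ht.2]) (by nlinarith [ht.1])
  set E := √((γ + 1 + 2 * √γ - t) * (t - γ - 1 + 2 * √γ)) with hE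
  have hE0 : 0 < E := Real.sqrt_pos.2 hpos
  have hE2 : E ^ 2 = (γ + 1 + 2 * √γ - t) * (t - γ - 1 + 2 * √γ) := Real.sq_sqrt hpos.le
  have hsq : ∀ x, √(γ * x) = √γ * √x := fun x => Real.sqrt_mul (by linarith) x
  have h1 : 1 - ((t - 1 + γ) / (2 * √(γ * t))) ^ 2 = (E / (2 * √γ * √t)) ^ 2 := by
    rw [hsq, div_pow, div_pow, hE2]
    have h2 : (2 * (√γ * √t)) ^ 2 = 4 * γ * t := by rw [mul_pow, mul_pow, hs2, hq2]; ring
    rw [mul_assoc 2, h2, eq_div_iff (by positivity), sub_mul, div_mul_cancel₀ _ (by positivity)]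
    linear_combination (-4) * hs2
  have h3 : 0 < E / (2 * √γ * √t) := by positivity
  have hlt : ((t - 1 + γ) / (2 * √(γ * t))) ^ 2 < 1 := by nlinarith [pow_pos h3 2]
  have hne1 : (t - 1 + γ) / (2 * √(γ * t)) ≠ -1 := fun h => by rw [h] at hlt; norm_num at hlt
  have hne2 : (t - 1 + γ) / (2 * √(γ * t)) ≠ 1 := fun h => by rw [h] at hlt; norm_num at hlt
  have hnum : HasDerivAt (fun x : ℝ => x - 1 + γ) 1 t :=
    ((hasDerivAt_id t).sub_const 1).add_const γ
  have hden : HasDerivAt (fun x : ℝ => 2 * √(γ * x)) (2 * (γ / (2 * √(γ * t)))) t := by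
    have := (((hasDerivAt_id t).const_mul γ).sqrt (mul_pos (by linarith) ht0).ne').const_mul 2
    simpa using this
  have hdiv := hnum.fun_div hden (by rw [hsq]; positivity)
  have h := ((Real.hasDerivAt_arccos hne1 hne2).comp t hdiv).const_mul (1 / Real.pi)
  refine HasDerivAt.congr_deriv h ?_
  rw [h1, Real.sqrt_sq h3.le, driftDensity, bulkWeight, ← hE, hsq]
  have hgs : γ / (2 * (√γ * √t)) = √γ / (2 * √t) := by
    rw [div_eq_div_iff (by positivity) (by positivity)]
    linear_combination (-2 * √t) * hs2
  rw [hgs]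
  have hpi := Real.pi_pos
  have h5 : (2 * (√γ * √t)) ^ 2 = 4 * √γ ^ 2 * t := by rw [mul_pow, mul_pow, hq2]; ring
  rw [h5]
  field_simp
  rw [hq2]
  ring

lemma integrableOn_pow_mul_limitDensity {γ : ℝ} (hγ : 1 < γ) (k : ℕ) :
    IntegrableOn (fun t => t ^ k * limitDensity γ t) (bulk γ) :=
  ((continuous_pow k).continuousOn.mul (continuousOn_limitDensity hγ)).integrableOn_compact
    isCompact_Icc

lemma bulk_le {γ : ℝ} : (√γ - 1) ^ 2 ≤ (√γ + 1) ^ 2 := by nlinarith [Real.sqrt_nonneg γ]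

/-- Integration by parts: the derivative of the limit density is -2 times `driftDensity`, and the
limit density vanishes at both ends of the bulk. -/
lemma integral_pow_mul_driftDensity {γ : ℝ} (hγ : 1 < γ) (k : ℕ) :
    ∫ t in bulk γ, t ^ k * driftDensity γ t =
      k / 2 * ∫ t in bulk γ, t ^ (k - 1) * limitDensity γ t := by
  have h1 := integrableOn_pow_mul_limitDensity hγ (k - 1)
  have h2 := integrableOn_pow_mul_driftDensity hγ k
  have hi : IntegrableOn (fun t => k * (t ^ (k - 1) * limitDensity γ t) -
      2 * (t ^ k * driftDensity γ t)) (bulk γ) := (h1.const_mul _).sub (h2.const_mul _)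
  have h := intervalIntegral.integral_eq_sub_of_hasDerivAt_of_le (bulk_le (γ := γ))
    (f := fun t => t ^ k * limitDensity γ t)
    (f' := fun t => k * (t ^ (k - 1) * limitDensity γ t) - 2 * (t ^ k * driftDensity γ t))
    ((continuous_pow k).continuousOn.mul (continuousOn_limitDensity hγ))
    (fun t ht => by
      refine ((hasDerivAt_pow k t).mul (hasDerivAt_limitDensity hγ ht)).congr_deriv ?_
      ring)
    ((intervalIntegrable_iff_integrableOn_Icc_of_le bulk_le).2 hi)
  rw [limitDensity_left hγ, limitDensity_right hγ, intervalIntegral.integral_of_le bulk_le,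
    ← integral_Icc_eq_integral_Ioc, ← bulk, integral_sub (h1.const_mul _) (h2.const_mul _),
    integral_const_mul, integral_const_mul] at h
  linarith

/-- The moment of order k + 1 of `driftDensity` is computed twice, in the angle and by parts, and
the common factor (k+1)/2 is cancelled. -/
lemma integral_pow_mul_limitDensity {γ : ℝ} (hγ : 1 < γ) (k : ℕ) :
    ∫ t in bulk γ, t ^ k * limitDensity γ t = limitMoment γ k := by
  have h1 := integral_pow_mul_driftDensity hγ (k + 1)
  rw [integral_pow_succ_mul_driftDensity hγ, Nat.add_sub_cancel] at h1
  push_cast at h1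
  exact (mul_left_cancel₀ (by positivity : ((k : ℝ) + 1) / 2 ≠ 0) h1).symm

lemma correctionDensity_eq (γ α t : ℝ) : correctionDensity γ α t =
    α * (t - 2 * α - γ - 1) / (γ + α ^ 2 + α * γ + α - α * t) * bulkWeight γ t -
      driftDensity γ t := by
  rw [correctionDensity, driftDensity, bulkWeight]
  ring

lemma integrableOn_pow_mul_correctionDensity {γ α : ℝ} (hγ : 1 < γ) (hα : 0 ≤ α) (k : ℕ) :
    IntegrableOn (fun t => t ^ k * correctionDensity γ α t) (bulk γ) ∧
    ∫ t in bulk γ, t ^ k * correctionDensity γ α t =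
      1 / Real.pi * (∫ θ in (0 : ℝ)..Real.pi, bulkParam γ θ ^ k * poissonPart (α / √γ) θ) -
        k / 2 * limitMoment γ (k - 1) := by
  have hγ0 : 0 < γ := by linarith
  have h1 : IntegrableOn (fun t => t ^ k * (α * (t - 2 * α - γ - 1) /
      (γ + α ^ 2 + α * γ + α - α * t)) * bulkWeight γ t) (bulk γ) := by
    rw [integrableOn_bulk_mul_bulkWeight_iff hγ0 (fun t => t ^ k * (α * (t - 2 * α - γ - 1) /
      (γ + α ^ 2 + α * γ + α - α * t)))]
    simp_rw [rational_part_bulkParam hγ0]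
    exact ((intervalIntegrable_poissonPart (by positivity)).const_mul 2).continuousOn_mul
      ((continuous_bulkParam γ).pow k).continuousOn
  have h2 : ∫ t in bulk γ, t ^ k * (α * (t - 2 * α - γ - 1) /
      (γ + α ^ 2 + α * γ + α - α * t)) * bulkWeight γ t =
      1 / Real.pi * ∫ θ in (0 : ℝ)..Real.pi, bulkParam γ θ ^ k * poissonPart (α / √γ) θ := by
    rw [integral_bulk_mul_bulkWeight hγ0 (fun t => t ^ k * (α * (t - 2 * α - γ - 1) /
      (γ + α ^ 2 + α * γ + α - α * t)))]
    simp_rw [rational_part_bulkParam hγ0, mul_left_comm _ (2 : ℝ)]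
    rw [intervalIntegral.integral_const_mul]
    field_simp
  have h3 := integrableOn_pow_mul_driftDensity hγ k
  have h4 : ∀ t, t ^ k * correctionDensity γ α t = t ^ k * (α * (t - 2 * α - γ - 1) /
      (γ + α ^ 2 + α * γ + α - α * t)) * bulkWeight γ t - t ^ k * driftDensity γ t := fun t => by
    rw [correctionDensity_eq]
    ring
  simp_rw [h4]
  refine ⟨h1.sub h3, ?_⟩
  rw [integral_sub h1 h3, h2, integral_pow_mul_driftDensity hγ, integral_pow_mul_limitDensity hγ]

end DiscreteBBP

/-! ### Integration against the signed measure, and its atoms -/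

namespace DiscreteBBP

section SignedDensity

variable {X : Type*} {mX : MeasurableSpace X} {μ : Measure X} {f g : X → ℝ}

lemma integrable_withDensity_ofReal (hf : AEMeasurable f μ) (hg : AEStronglyMeasurable g μ)
    (hgf : Integrable (fun x => g x * f x) μ) :
    Integrable g (μ.withDensity fun x => ENNReal.ofReal (f x)) := by
  rw [integrable_withDensity_iff_integrable_smul₀' hf.ennreal_ofReal (by simp)]
  refine hgf.mono (hf.ennreal_ofReal.ennreal_toReal.aestronglyMeasurable.smul hg)
    (Eventually.of_forall fun x => ?_)
  rw [smul_eq_mul, mul_comm, norm_mul, norm_mul]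
  gcongr
  rw [ENNReal.toReal_ofReal', Real.norm_eq_abs, Real.norm_eq_abs, abs_of_nonneg (le_max_right _ _)]
  exact max_le (le_abs_self _) (abs_nonneg _)

lemma integral_withDensity_ofReal (hf : AEMeasurable f μ) :
    ∫ x, g x ∂(μ.withDensity fun x => ENNReal.ofReal (f x)) = ∫ x, g x * max (f x) 0 ∂μ := by
  rw [integral_withDensity_eq_integral_toReal_smul₀ hf.ennreal_ofReal (by simp)]
  simp only [ENNReal.toReal_ofReal', smul_eq_mul, mul_comm]

lemma integrable_withDensityᵥ (hf : Integrable f μ) (hg : AEStronglyMeasurable g μ)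
    (hgf : Integrable (fun x => g x * f x) μ) : (μ.withDensityᵥ f).Integrable g := by
  rw [VectorMeasure.Integrable, Measure.variation_withDensityᵥ hf]
  simp_rw [Real.enorm_eq_ofReal_abs]
  refine integrable_withDensity_ofReal hf.1.aemeasurable.abs hg (hgf.mono
    (hg.mul hf.abs.1) (Eventually.of_forall fun x => ?_))
  simp

/-- The density is split into positive and negative parts, each giving a finite positive measure.
The integral of g is then a difference of ordinary integrals. -/
lemma integral_withDensityᵥ (hf : Integrable f μ) (hg : AEStronglyMeasurable g μ)
    (hgf : Integrable (fun x => g x * f x) μ) :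
    ∫ᵛ x, g x ∂•(μ.withDensityᵥ f) = ∫ x, g x * f x ∂μ := by
  have hflip : ContinuousLinearMap.lsmul ℝ ℝ = (ContinuousLinearMap.lsmul ℝ ℝ).flip := by
    ext
    simp
  have := isFiniteMeasure_withDensity_ofReal hf.2
  have := isFiniteMeasure_withDensity_ofReal hf.neg.2
  have hfm := hf.1.aemeasurable
  have hfn : AEMeasurable (fun x => -f x) μ := hfm.neg
  have h1 := integrable_withDensity_ofReal hfm hg hgf
  have h2 := integrable_withDensity_ofReal hfn hg
    (by simpa using hgf.neg)
  have h3 : ∀ {h : X → ℝ}, AEMeasurable h μ → Integrable (fun x => g x * h x) μ →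
      Integrable (fun x => g x * max (h x) 0) μ := fun {h} hh hi =>
    hi.mono (hg.mul (hh.max aemeasurable_const).aestronglyMeasurable)
      (Eventually.of_forall fun x => by
        rw [norm_mul, norm_mul]
        gcongr
        rw [Real.norm_eq_abs, Real.norm_eq_abs, abs_of_nonneg (le_max_right _ _)]
        exact max_le (le_abs_self _) (abs_nonneg _))
  rw [withDensityᵥ_eq_withDensity_pos_part_sub_withDensity_neg_part hf,
    VectorMeasure.integral_sub_vectorMeasure
      (by rw [VectorMeasure.Integrable, Measure.variation_toSignedMeasure]; exact h1)
      (by rw [VectorMeasure.Integrable, Measure.variation_toSignedMeasure]; exact h2), hflip,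
    VectorMeasure.integral_toSignedMeasure, VectorMeasure.integral_toSignedMeasure,
    integral_withDensity_ofReal hfm, integral_withDensity_ofReal hfn,
    ← integral_sub (h3 hfm hgf) (h3 hfn (by simpa using hgf.neg))]
  refine integral_congr_ae (Eventually.of_forall fun x => ?_)
  simp only
  rw [← mul_sub]
  congr 1
  rcases le_total (f x) 0 with h | h
  · rw [max_eq_right h, max_eq_left (by linarith)]; ring
  · rw [max_eq_left h, max_eq_right (by linarith)]; ring

end SignedDensity

lemma limitMeasure_eq (γ : ℝ) : limitMeasure γ =
    (volume.restrict (bulk γ)).withDensity fun t => ENNReal.ofReal (limitDensity γ t) := rfl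

lemma limitDensity_nonneg (γ t : ℝ) : 0 ≤ limitDensity γ t :=
  mul_nonneg (by positivity) (Real.arccos_nonneg _)

lemma measurable_limitDensity (γ : ℝ) : Measurable (limitDensity γ) :=
  (Real.continuous_arccos.measurable.comp (by fun_prop)).const_mul _

lemma integrable_pow_limitMeasure {γ : ℝ} (hγ : 1 < γ) (k : ℕ) :
    Integrable (fun t : ℝ => t ^ k) (limitMeasure γ) :=
  integrable_withDensity_ofReal (measurable_limitDensity γ).aemeasurable
    (continuous_pow k).aestronglyMeasurable (integrableOn_pow_mul_limitDensity hγ k)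

lemma integral_pow_limitMeasure {γ : ℝ} (hγ : 1 < γ) (k : ℕ) :
    ∫ t, t ^ k ∂limitMeasure γ = limitMoment γ k := by
  rw [limitMeasure_eq, integral_withDensity_ofReal (measurable_limitDensity γ).aemeasurable]
  simp_rw [max_eq_left (limitDensity_nonneg γ _)]
  exact integral_pow_mul_limitDensity hγ k

lemma isProbabilityMeasure_limitMeasure {γ : ℝ} (hγ : 1 < γ) :
    IsProbabilityMeasure (limitMeasure γ) := by
  have h1 := integral_pow_limitMeasure hγ 0
  have h2 : limitMoment γ 0 = 1 := by simp [limitMoment]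
  rw [h2] at h1
  simp only [pow_zero, integral_const, smul_eq_mul, mul_one, measureReal_def] at h1
  exact ⟨(ENNReal.toReal_eq_one_iff _).1 h1⟩

lemma integrableOn_correctionDensity {γ α : ℝ} (hγ : 1 < γ) (hα : 0 ≤ α) :
    IntegrableOn (correctionDensity γ α) (bulk γ) := by
  simpa using (integrableOn_pow_mul_correctionDensity hγ hα 0).1

lemma integrable_pow_dirac (x m : ℝ) (k : ℕ) :
    (VectorMeasure.dirac x m : SignedMeasure ℝ).Integrable (fun t : ℝ => t ^ k) := by
  rw [VectorMeasure.Integrable, VectorMeasure.variation_dirac]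
  exact (integrable_dirac (by simp)).smul_measure enorm_ne_top

lemma integrable_pow_correctionMeasure {γ α : ℝ} (hγ : 1 < γ) (hα : 0 ≤ α) (k : ℕ) :
    (correctionMeasure γ α).Integrable (fun t : ℝ => t ^ k) :=
  (integrable_withDensityᵥ (integrableOn_correctionDensity hγ hα)
    (continuous_pow k).aestronglyMeasurable
    (integrableOn_pow_mul_correctionDensity hγ hα k).1).add_vectorMeasure (integrable_pow_dirac _ _ k)

lemma integral_pow_correctionMeasure {γ α : ℝ} (hγ : 1 < γ) (hα : 0 ≤ α) (k : ℕ) :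
    ∫ᵛ t, t ^ k ∂•(correctionMeasure γ α) =
      spikeMoment γ α k - k / 2 * limitMoment γ (k - 1) := by
  have h1 := integrableOn_correctionDensity hγ hα
  have h2 := integrableOn_pow_mul_correctionDensity hγ hα k
  have hm : AEStronglyMeasurable (fun t : ℝ => t ^ k) (volume.restrict (bulk γ)) :=
    (continuous_pow k).aestronglyMeasurable
  rw [correctionMeasure, VectorMeasure.integral_add_vectorMeasure
    (integrable_withDensityᵥ h1 hm h2.1) (integrable_pow_dirac _ _ k),
    integral_withDensityᵥ h1 hm h2.1, VectorMeasure.integral_dirac, h2.2,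
    ← integral_bulkParam_pow_mul_poissonPart (γ := γ) (by linarith) hα k]
  simp only [ContinuousLinearMap.lsmul_apply, smul_eq_mul]
  ring

/-- The absolutely continuous part does not charge points. For α = 0 the junk value γ/0 = 0 still
places a Dirac term, but its mass is zero since √γ > 0. -/
lemma correctionMeasure_singleton {γ α : ℝ} (hγ : 1 < γ) (hα : 0 ≤ α) (x : ℝ) :
    correctionMeasure γ α {x} = if x = outlier γ α then outlierMass γ α else 0 := by
  have h0 : (volume.restrict (bulk γ)).withDensityᵥ (correctionDensity γ α) {x} = 0 := by
    rw [withDensityᵥ_apply (integrableOn_correctionDensity hγ hα) (measurableSet_singleton x)]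
    exact setIntegral_measure_zero _
      (Measure.absolutelyContinuous_of_le Measure.restrict_le_self (by simp))
  rw [correctionMeasure, add_apply, h0, zero_add]
  split_ifs with h
  · rw [VectorMeasure.dirac_apply_of_mem (measurableSet_singleton x) h.symm]
  · rw [VectorMeasure.dirac_apply_of_notMem fun h' => h h'.symm]

lemma HasExpansion.isLittleO {x : ℕ → ℝ} {a b : ℝ} (h : HasExpansion x a b) :
    (fun N : ℕ => x N - (a + 1 / (N : ℝ) * b)) =o[atTop] fun N : ℕ => 1 / (N : ℝ) := by
  rw [isLittleO_iff_tendsto' ((eventually_ge_atTop 1).mono fun N hN h0 => by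
    have : (N : ℝ) ≠ 0 := by positivity
    exact absurd h0 (one_div_ne_zero this))]
  have h1 : Tendsto (fun N : ℕ => (N : ℝ) * (x N - a) - b) atTop (𝓝 0) := by
    simpa using Tendsto.sub_const h b
  refine h1.congr' ((eventually_ge_atTop 1).mono fun N hN => ?_)
  have : (N : ℝ) ≠ 0 := by positivity
  field_simp
  ring

end DiscreteBBP

theorem mainTheorem10 (γ α : ℝ) (hγ : 1 < γ) (hα : 0 ≤ α)
    (ρ : ∀ N : ℕ, PMF (DiscreteBBP.Signature N))
    (hρ : ∀ N : ℕ, 1 ≤ N → ∀ u : Fin N → ℂ, (∀ i, ‖u i‖ = 1) →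
      DiscreteBBP.schurGenFun (ρ N) u =
        ∏ i : Fin N, Complex.exp ((γ : ℂ) * (N : ℂ) * (u i - 1)) *
          (1 / (1 - (α : ℂ) * (u i - 1)))) :
    -- the limit is a probability measure, and the density of the correction is integrable
    IsProbabilityMeasure (DiscreteBBP.limitMeasure γ) ∧
    IntegrableOn (DiscreteBBP.correctionDensity γ α) (DiscreteBBP.bulk γ) volume ∧
    -- the atoms of the correction measure
    (∀ x : ℝ, DiscreteBBP.correctionMeasure γ α {x} =
      if x = DiscreteBBP.outlier γ α then
        (if √γ < α then 1 else if α = √γ then 1 / 2 else 0) else 0) ∧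
    -- the expansion of the averaged moments
    ∀ k : ℕ,
      (∀ N : ℕ, 1 ≤ N → Summable fun l : DiscreteBBP.Signature N =>
        (ρ N l).toReal * |DiscreteBBP.powerSum k l|) ∧
      Integrable (fun t : ℝ => t ^ k) (DiscreteBBP.limitMeasure γ) ∧
      (DiscreteBBP.correctionMeasure γ α).Integrable (fun t : ℝ => t ^ k) ∧
      (fun N : ℕ => DiscreteBBP.averagedMoment (ρ N) k -
          ((∫ t, t ^ k ∂DiscreteBBP.limitMeasure γ) +
            (1 / (N : ℝ)) * ∫ᵛ t, t ^ k ∂•(DiscreteBBP.correctionMeasure γ α)))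
        =o[atTop] fun N : ℕ => 1 / (N : ℝ) := by
  have hγ0 : 0 ≤ γ := by linarith
  refine ⟨DiscreteBBP.isProbabilityMeasure_limitMeasure hγ,
    DiscreteBBP.integrableOn_correctionDensity hγ hα,
    DiscreteBBP.correctionMeasure_singleton hγ hα, fun k =>
    ⟨fun N hN => DiscreteBBP.summable_powerSum hγ0 hα hρ k hN,
      DiscreteBBP.integrable_pow_limitMeasure hγ k,
      DiscreteBBP.integrable_pow_correctionMeasure hγ hα k, ?_⟩⟩
  rw [DiscreteBBP.integral_pow_limitMeasure hγ, DiscreteBBP.integral_pow_correctionMeasure hγ hα]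
  exact (DiscreteBBP.hasExpansion_averagedMoment hγ0 hα hρ k).isLittleO
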